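/- Let $k$ be a field, $n\ge 0$, and let $R=k[x_1,\dots,x_n]$ be graded by $\deg x_i=1$, with $\mathfrak m=(x_1,\dots,x_n)$. A monomial ideal $I\subseteq R$ is called weakly stable if for every monomial $u\in I$, $u\neq 1$, with $m$ the largest index of a variable dividing $u$ and $x_m^{l}$ the highest power of $x_m$ dividing $u$, and for every $j<m$, there is an integer $c\ge 0$ with $x_j^{c}\,u/x_m^{l}\in I$. For a graded $R$-module $M$ let $H^j_{\mathfrak m}(M)$ be the $j$-th right derived functor, in the category of graded $R$-modules with homogeneous maps of degree $0$, of $\Gamma_{\mathfrak m}(M)=\{x\in M:\mathfrak m^t x=0\text{ for some }t\}$, and let $$\operatorname{reg} M=\sup_{j\ge 0}\bigl(\sup\{d\in\mathbb Z : H^j_{\mathfrak m}(M)_d\neq 0\}+j\bigr),$$ where the supremum of the empty set is $-\infty$. Theorem. If $I$ is a weakly stable ideal of $R$, then the graded $R$-modules $\operatorname{Ext}^i_R(R/I,R)$ satisfy $$\operatorname{reg}\operatorname{Ext}^i_R(R/I,R)\le -i\qquad\text{for every } i\ge 0.$$ -/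

import Mathlib

open CategoryTheory CategoryTheory.Limits

universe u

noncomputable section

namespace GradedReg

/-! ### The category of `ℤ`-graded modules over `R = k[x_0, …, x_{n-1}]`, `deg x_i = 1`

A graded `R`-module is a family `(M_d)_{d ∈ ℤ}` of `k`-vector spaces together with, for each monomial
`x^a`, multiplication maps `x^a : M_d → M_{d + |a|}`, with `x^0 = id` and `x^(a+b) = x^b ∘ x^a`.
This is literally a functor to `k`-vector spaces from the category whose objects are the integers
(degrees) and whose morphisms `d ⟶ e` are the monomials of degree `e - d`; natural transformations
are the `R`-linear maps which are homogeneous of degree `0`. -/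

/-- A degree: an integer, regarded as an object of the category of monomials. -/
structure Deg (n : ℕ) : Type where
  /-- the underlying integer -/
  val : ℤ

/-- A morphism `d ⟶ e` is (the exponent vector of) a monomial of degree `e - d`. -/
@[ext]
structure Deg.Hom {n : ℕ} (d e : Deg n) : Type where
  /-- the exponent vector -/
  exp : Fin n →₀ ℕ
  deg_eq : d.val + (exp.degree : ℤ) = e.val

/-- Composition of morphisms is multiplication of monomials. -/
instance (n : ℕ) : SmallCategory (Deg n) where
  Hom d e := Deg.Hom d e
  id d := ⟨0, by simp⟩
  comp f g := ⟨f.exp + g.exp, by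
    rw [map_add, Nat.cast_add, ← add_assoc, f.deg_eq, g.deg_eq]⟩
  id_comp f := Deg.Hom.ext (zero_add _)
  comp_id f := Deg.Hom.ext (add_zero _)
  assoc f g h := Deg.Hom.ext (add_assoc _ _ _)

/-- The category of `ℤ`-graded `k[x_0, …, x_{n-1}]`-modules and homogeneous maps of degree `0`. -/
abbrev GrMod (n : ℕ) (k : Type u) [Field k] : Type (u + 1) := Deg n ⥤ ModuleCat.{u} k

variable {n : ℕ} {k : Type u} [Field k]

instance : IsGrothendieckAbelian.{u} ((Deg n)ᵒᵖᵒᵖ ⥤ ModuleCat.{u} k) where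
  hasFilteredColimitsOfSize := ⟨fun _ _ _ => inferInstance⟩
  ab5OfSize := ⟨fun _ _ _ => inferInstance⟩
  hasSeparator := inferInstance

instance : EnoughInjectives (GrMod n k) :=
  EnoughInjectives.of_equivalence
    ((opOpEquivalence (Deg n)).congrLeft (E := ModuleCat.{u} k)).inverse

instance : HasExt.{u} (GrMod n k) := hasExt_of_enoughInjectives _

/-! ### Graded modules coming from ungraded ones -/

/-- The graded module with components `ℳ d`, where the `ℳ d` are `k`-subspaces of an `R`-module `M`
such that `x^a • ℳ d ⊆ ℳ (d + |a|)`. -/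
def ofComponents {M : Type u} [AddCommGroup M] [Module k M] [Module (MvPolynomial (Fin n) k) M]
    [IsScalarTower k (MvPolynomial (Fin n) k) M] (ℳ : ℤ → Submodule k M)
    (h : ∀ (d : ℤ) (a : Fin n →₀ ℕ), ∀ x ∈ ℳ d,
      (MvPolynomial.monomial a (1 : k)) • x ∈ ℳ (d + (a.degree : ℤ))) : GrMod n k where
  obj d := ModuleCat.of k (ℳ d.val)
  map {d e} f := ModuleCat.ofHom
    ((Module.toModuleEnd k (S := MvPolynomial (Fin n) k) M
      (MvPolynomial.monomial f.exp (1 : k))).restrict (p := ℳ d.val) (q := ℳ e.val)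
      (fun x hx => f.deg_eq ▸ h d.val f.exp x hx))
  map_id d := by
    ext x
    change MvPolynomial.monomial (0 : Fin n →₀ ℕ) (1 : k) • x.1 = x.1
    exact one_smul _ _
  map_comp f g := by
    ext x
    change MvPolynomial.monomial (f.exp + g.exp) (1 : k) • x.1 =
      MvPolynomial.monomial g.exp (1 : k) • MvPolynomial.monomial f.exp (1 : k) • x.1
    rw [smul_smul, MvPolynomial.monomial_mul, one_mul, add_comm]

/-- `R_d`: the polynomials all of whose monomials have degree `d ∈ ℤ` (it is `0` for `d < 0`). -/
def polyPart (n : ℕ) (k : Type u) [Field k] (d : ℤ) : Submodule k (MvPolynomial (Fin n) k) where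
  carrier := {p | ∀ a : Fin n →₀ ℕ, p.coeff a ≠ 0 → (a.degree : ℤ) = d}
  zero_mem' := by simp
  add_mem' {p q} hp hq a ha := by
    by_cases h : p.coeff a = 0
    · exact hq a (by simpa [h] using ha)
    · exact hp a h
  smul_mem' c p hp a ha := hp a (by
    intro h
    simp [h] at ha)

lemma monomial_mul_mem_polyPart (d : ℤ) (b : Fin n →₀ ℕ) (p : MvPolynomial (Fin n) k)
    (hp : p ∈ polyPart n k d) :
    MvPolynomial.monomial b (1 : k) * p ∈ polyPart n k (d + (b.degree : ℤ)) := by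
  intro a ha
  rw [MvPolynomial.coeff_monomial_mul'] at ha
  split_ifs at ha with hba
  · have h1 := hp (a - b) (by simpa using ha)
    have h2 : a.degree = (a - b).degree + b.degree := by
      rw [← map_add, tsub_add_cancel_of_le hba]
    rw [h2, Nat.cast_add, h1]
  · exact absurd rfl ha

/-- `R` as a graded module over itself. -/
def polyRing (n : ℕ) (k : Type u) [Field k] : GrMod n k :=
  ofComponents (M := MvPolynomial (Fin n) k) (polyPart n k)
    (fun d b p hp => monomial_mul_mem_polyPart d b p hp)

/-- `R/I` as a graded module, for a homogeneous ideal `I`: the component `(R/I)_d` is the image of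
`R_d` in `R/I`. -/
def quotientRing (I : Ideal (MvPolynomial (Fin n) k)) : GrMod n k :=
  ofComponents (M := MvPolynomial (Fin n) k ⧸ I)
    (fun d => (polyPart n k d).map (Ideal.Quotient.mkₐ k I).toLinearMap)
    (by
      rintro d b _ ⟨p, hp, rfl⟩
      exact ⟨_, monomial_mul_mem_polyPart d b p hp, rfl⟩)

/-! ### Shifts and graded `Ext` -/

/-- Addition of degrees (on objects) and multiplication of monomials (on morphisms). -/
def Deg.add (n : ℕ) : Deg n ⥤ Deg n ⥤ Deg n where
  obj d :=
    { obj := fun e => ⟨d.val + e.val⟩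
      map := fun g => ⟨g.exp, by rw [add_assoc, g.deg_eq]⟩ }
  map {d d'} f :=
    { app := fun e => ⟨f.exp, by
        change d.val + e.val + _ = d'.val + e.val
        rw [add_right_comm, f.deg_eq]⟩
      naturality := fun _ _ g => Deg.Hom.ext (add_comm g.exp f.exp) }

/-- The shift `N(d)`, with `N(d)_e = N_{d+e}`. -/
abbrev shift (N : GrMod n k) (d : Deg n) : GrMod n k := (Deg.add n).obj d ⋙ N

/-- Multiplication by a monomial of degree `e - d`, as a degree `0` map `N(d) ⟶ N(e)`. -/
abbrev shiftMul (N : GrMod n k) {d e : Deg n} (f : d ⟶ e) : shift N d ⟶ shift N e :=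
  Functor.whiskerRight ((Deg.add n).map f) N

/-- The graded module `Ext^i_R(M, N)`. Its component of degree `d` is the `i`-th `Ext` group from `M`
to `N(d)` in the abelian category of graded modules (for `i = 0`: the homogeneous maps `M → N` of
degree `d`), and `R` acts through its action on `N`. For finitely generated `M`, the direct sum of
the components is the usual `Ext^i_R(M, N)`. -/
def gradedExt (i : ℕ) (M N : GrMod n k) : GrMod n k where
  obj d := ModuleCat.of k (Abelian.Ext.{u} M (shift N d) i)
  map f := ModuleCat.ofHom
    (Abelian.Ext.postcompOfLinear (Abelian.Ext.mk₀ (shiftMul N f)) k M (add_zero i))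
  map_id d := by
    ext x
    change x.comp (Abelian.Ext.mk₀ (shiftMul N (𝟙 d))) (add_zero i) = x
    rw [shiftMul, CategoryTheory.Functor.map_id, Functor.whiskerRight_id']
    exact Abelian.Ext.comp_mk₀_id x
  map_comp f g := by
    ext x
    change x.comp (Abelian.Ext.mk₀ (shiftMul N (f ≫ g))) (add_zero i) =
      (x.comp (Abelian.Ext.mk₀ (shiftMul N f)) (add_zero i)).comp
        (Abelian.Ext.mk₀ (shiftMul N g)) (add_zero i)
    rw [Abelian.Ext.comp_assoc_of_second_deg_zero, Abelian.Ext.mk₀_comp_mk₀, shiftMul, shiftMul,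
      shiftMul, Functor.map_comp, Functor.whiskerRight_comp]

/-! ### Local cohomology and regularity -/

/-- The elements of `M_d` killed by some power `𝔪^t` of `𝔪 = (x_0, …, x_{n-1})`; as `𝔪^t` is spanned
by the monomials of degree at least `t`, this means being killed by all these monomials. -/
def torsionPart (M : GrMod n k) (d : Deg n) : Submodule k (M.obj d) where
  carrier := {x | ∃ t : ℕ, ∀ (e : Deg n) (f : d ⟶ e), t ≤ f.exp.degree → (M.map f).hom x = 0}
  zero_mem' := ⟨0, fun _ _ _ => map_zero _⟩
  add_mem' := by
    rintro x y ⟨s, hs⟩ ⟨t, ht⟩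
    refine ⟨max s t, fun e f h => ?_⟩
    rw [map_add, hs e f (le_trans (le_max_left _ _) h), ht e f (le_trans (le_max_right _ _) h),
      add_zero]
  smul_mem' := by
    rintro c x ⟨t, ht⟩
    exact ⟨t, fun e f h => by rw [map_smul, ht e f h, smul_zero]⟩

lemma map_mem_torsionPart (M : GrMod n k) {d e : Deg n} (f : d ⟶ e) (x : M.obj d)
    (hx : x ∈ torsionPart M d) : (M.map f).hom x ∈ torsionPart M e := by
  obtain ⟨t, ht⟩ := hx
  refine ⟨t, fun e' g h => ?_⟩
  have h1 := ht e' (f ≫ g) (by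
    change t ≤ (f.exp + g.exp).degree
    rw [map_add]
    omega)
  rwa [Functor.map_comp] at h1

lemma app_mem_torsionPart {M N : GrMod n k} (φ : M ⟶ N) (d : Deg n) (x : M.obj d)
    (hx : x ∈ torsionPart M d) : (φ.app d).hom x ∈ torsionPart N d := by
  obtain ⟨t, ht⟩ := hx
  refine ⟨t, fun e f h => ?_⟩
  have h1 := congrArg (fun ψ => ψ.hom x) (φ.naturality f)
  change (φ.app e).hom ((M.map f).hom x) = (N.map f).hom ((φ.app d).hom x) at h1
  rw [← h1, ht e f h, map_zero]

/-- The `𝔪`-torsion functor `Γ_𝔪` on graded modules. -/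
def torsion (n : ℕ) (k : Type u) [Field k] : GrMod n k ⥤ GrMod n k where
  obj M :=
    { obj := fun d => ModuleCat.of k (torsionPart M d)
      map := fun f => ModuleCat.ofHom ((M.map f).hom.restrict (map_mem_torsionPart M f))
      map_id := fun d => by
        ext x
        change (M.map (𝟙 d)).hom x.1 = x.1
        simp
      map_comp := fun f g => by
        ext x
        change (M.map (f ≫ g)).hom x.1 = (M.map g).hom ((M.map f).hom x.1)
        simp }
  map {M N} φ :=
    { app := fun d => ModuleCat.ofHom ((φ.app d).hom.restrict (app_mem_torsionPart φ d))
      naturality := fun d e f => by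
        ext x
        exact congrArg (fun ψ => ψ.hom x.1) (φ.naturality f) }
  map_id M := rfl
  map_comp φ ψ := rfl

instance : (torsion n k).Additive where
  map_add := rfl

/-- Local cohomology `H^i_𝔪(M)`: the `i`-th right derived functor of `Γ_𝔪` in the category of
graded modules. -/
def localCohomology (i : ℕ) (M : GrMod n k) : GrMod n k := ((torsion n k).rightDerived i).obj M

/-- `sup M = sup {d | M_d ≠ 0}`, which is `-∞` for `M = 0`. -/
def degSup (M : GrMod n k) : EReal :=
  ⨆ (d : Deg n) (_ : Nontrivial (M.obj d)), ((d.val : ℝ) : EReal)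

/-- The Castelnuovo-Mumford regularity `reg M = sup_i (sup H^i_𝔪(M) + i)`; it is `-∞` for
`M = 0`. -/
def reg (M : GrMod n k) : EReal := ⨆ i : ℕ, (degSup (localCohomology i M) + ((i : ℝ) : EReal))

/-! ### Weakly stable ideals -/

/-- A monomial ideal: an ideal generated by a set of monomials. -/
def IsMonomialIdeal (I : Ideal (MvPolynomial (Fin n) k)) : Prop :=
  ∃ S : Set (Fin n →₀ ℕ), I = Ideal.span ((fun a => MvPolynomial.monomial a (1 : k)) '' S)

/-- A monomial ideal `I` is weakly stable if for each monomial `x^a ∈ I`, where `m` is the largest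
index of a variable dividing `x^a`, and each `j < m`, there is `c` with
`x_j^c * x^a / x_m^(a m) ∈ I`. (There is no condition on the monomial `1`.) -/
def IsWeaklyStable (I : Ideal (MvPolynomial (Fin n) k)) : Prop :=
  IsMonomialIdeal I ∧
    ∀ a : Fin n →₀ ℕ, MvPolynomial.monomial a (1 : k) ∈ I →
      ∀ m : Fin n, IsGreatest {i : Fin n | a i ≠ 0} m → ∀ j < m, ∃ c : ℕ,
        MvPolynomial.monomial (Finsupp.single j c + (a - Finsupp.single m (a m))) (1 : k) ∈ I

end GradedReg

end

noncomputable section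

namespace GradedReg

variable {n : ℕ} {k : Type u} [Field k]

/-! ### Pointwise criteria in the category of graded modules -/

/-! A weakly stable ideal `I` has a filtration of `R/I` by cyclic submodules `(R/(x_0, …,
x_{m-1}))(-u)`, with `m` only decreasing as one passes to quotients. Such a factor is Cohen-Macaulay
of codimension `m`: its `Ext^i` into `R` vanishes for `i ≠ m`, and `Ext^m` is `(R/(x_0, …,
x_{m-1}))(|u| + m)`, of regularity `-|u| - m ≤ -m`. If a factor of codimension `m` is the submodule
and the quotient only involves codimensions at most `m`, all connecting maps of the long exact
`Ext(-, R)` sequence vanish: either the source is zero, or the target lies in cohomological degree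
`m + 1`. Hence `Ext^i(R/I, R)` is an iterated extension of modules of regularity at most `-i`.
Regularity is controlled by `ExtVanishAbove c M`: `Ext^a(k(-e), M) = 0` for `a + e > c`. This passes
to extensions and implies `reg M ≤ c` (`reg_le`), because an `𝔪`-torsion cocycle in an injective
resolution comes from a map out of a shift of some `R/𝔪^t`, which is filtered by copies of `k`. The
modules `Ext^m` of the factors are never computed. The bound for them
(`extVanishAbove_gradedExt_coneModule`) follows from killing variables one at a time: `x_j` acts by
zero on `Ext(M, -)` when it kills `M`, so multiplication by `x_j` on the second argument yields
vanishing by dimension shift. The filtration comes from `exists_isCorner`: if `I` is generated in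
the variables `x_0, …, x_m` but not in `x_0, …, x_{m-1}`, weak stability gives a monomial whose
colon ideal is `(x_0, …, x_m)`. Adding it to `I` keeps weak stability (`IsCorner.weaklyStableSet`),
and Noetherian induction finishes (`extBounds_stdSet`). -/

lemma exact_of_forall_degree (S : ShortComplex (GrMod n k))
    (h : ∀ d : Deg n, ∀ x : S.X₂.obj d, (S.g.app d).hom x = 0 →
      ∃ y : S.X₁.obj d, (S.f.app d).hom y = x) : S.Exact := by
  rw [ShortComplex.exact_iff_isZero_homology]
  refine (Functor.isZero_iff _).2 fun d => ?_
  refine IsZero.of_iso ?_ (S.mapHomologyIso ((evaluation (Deg n) (ModuleCat.{u} k)).obj d)).symm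
  rw [← ShortComplex.exact_iff_isZero_homology, ShortComplex.moduleCat_exact_iff]
  exact h d

lemma mono_of_forall_degree {M N : GrMod n k} (f : M ⟶ N)
    (h : ∀ d, Function.Injective (f.app d).hom) : Mono f :=
  (NatTrans.mono_iff_mono_app f).2 fun d => (ModuleCat.mono_iff_injective _).2 (h d)

lemma epi_of_forall_degree {M N : GrMod n k} (f : M ⟶ N)
    (h : ∀ d, Function.Surjective (f.app d).hom) : Epi f :=
  (NatTrans.epi_iff_epi_app f).2 fun d => (ModuleCat.epi_iff_surjective _).2 (h d)

lemma surjective_app {M N : GrMod n k} (f : M ⟶ N) [Epi f] (d : Deg n) :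
    Function.Surjective (f.app d).hom :=
  (ModuleCat.epi_iff_surjective _).1 inferInstance

lemma shortExact_of_forall_degree (S : ShortComplex (GrMod n k))
    (hf : ∀ d, Function.Injective (S.f.app d).hom)
    (h : ∀ d : Deg n, ∀ x : S.X₂.obj d, (S.g.app d).hom x = 0 →
      ∃ y : S.X₁.obj d, (S.f.app d).hom y = x)
    (hg : ∀ d, Function.Surjective (S.g.app d).hom) : S.ShortExact where
  exact := exact_of_forall_degree S h
  mono_f := mono_of_forall_degree _ hf
  epi_g := epi_of_forall_degree _ hg

lemma isIso_of_forall_degree {M N : GrMod n k} (f : M ⟶ N)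
    (h : ∀ d, Function.Bijective (f.app d).hom) : IsIso f := by
  have := mono_of_forall_degree f fun d => (h d).1
  have := epi_of_forall_degree f fun d => (h d).2
  exact isIso_of_mono_of_epi f

lemma map_comp_apply (M : GrMod n k) {d e e' : Deg n} (f : d ⟶ e) (g : e ⟶ e') (x : M.obj d) :
    (M.map (f ≫ g)).hom x = (M.map g).hom ((M.map f).hom x) := by
  rw [M.map_comp]; rfl

lemma map_id_apply (M : GrMod n k) (d : Deg n) (x : M.obj d) : (M.map (𝟙 d)).hom x = x := by
  rw [M.map_id]; rfl

lemma map_map_eq_map (M : GrMod n k) {d e e' : Deg n} (f : d ⟶ e) (g : e ⟶ e') (h : d ⟶ e')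
    (hfg : f.exp + g.exp = h.exp) (x : M.obj d) :
    (M.map g).hom ((M.map f).hom x) = (M.map h).hom x := by
  rw [← map_comp_apply]
  congr 3
  exact Deg.Hom.ext hfg

lemma map_map_eq_map_map (M : GrMod n k) {d e e₁ e' : Deg n} (f : d ⟶ e) (g : e ⟶ e')
    (f₁ : d ⟶ e₁) (g₁ : e₁ ⟶ e') (h : f.exp + g.exp = f₁.exp + g₁.exp) (x : M.obj d) :
    (M.map g).hom ((M.map f).hom x) = (M.map g₁).hom ((M.map f₁).hom x) := by
  rw [← map_comp_apply M f₁]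
  exact map_map_eq_map M f g _ h x

lemma naturality_apply {M N : GrMod n k} (φ : M ⟶ N) {d e : Deg n} (f : d ⟶ e) (x : M.obj d) :
    (φ.app e).hom ((M.map f).hom x) = (N.map f).hom ((φ.app d).hom x) :=
  congrArg (fun ψ => ψ.hom x) (φ.naturality f)

/-! ### Multiplication by a variable, and its action on `Ext` -/

/-- The shift by `d` as a functor. -/
abbrev shiftFunctor (n : ℕ) (k : Type u) [Field k] (d : Deg n) : GrMod n k ⥤ GrMod n k :=
  (Functor.whiskeringLeft _ _ (ModuleCat.{u} k)).obj ((Deg.add n).obj d)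

lemma shortExact_shift {S : ShortComplex (GrMod n k)} (hS : S.ShortExact) (d : Deg n) :
    (S.map (shiftFunctor n k d)).ShortExact := by
  have : PreservesFiniteLimits (shiftFunctor n k d) :=
    ⟨fun J _ _ => whiskeringLeft_preservesLimitsOfShape J _⟩
  have : PreservesFiniteColimits (shiftFunctor n k d) :=
    ⟨fun J _ _ => whiskeringLeft_preservesColimitsOfShape J _⟩
  exact hS.map_of_exact _

/-- Multiplication by `x_j`, as a morphism in the category of degrees. -/
def Deg.mulVar (j : Fin n) (d : Deg n) : d ⟶ ((Deg.add n).obj ⟨1⟩).obj d :=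
  ⟨Finsupp.single j 1, by simp [Deg.add, add_comm]⟩

/-- Multiplication by `x_j`, as a map of graded modules `N ⟶ N(1)`. -/
def varMul (j : Fin n) (N : GrMod n k) : N ⟶ shift N ⟨1⟩ where
  app d := N.map (Deg.mulVar j d)
  naturality d e f := by
    change N.map f ≫ N.map _ = N.map _ ≫ N.map _
    rw [← N.map_comp, ← N.map_comp]
    exact congrArg N.map (Deg.Hom.ext (add_comm _ _))

lemma varMul_naturality (j : Fin n) {M N : GrMod n k} (φ : M ⟶ N) :
    φ ≫ varMul j N = varMul j M ≫ (shiftFunctor n k ⟨1⟩).map φ := by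
  ext d : 2
  exact (φ.naturality (Deg.mulVar j d)).symm

/-- Multiplication by a variable acts by zero on `Ext(M, N)` if it acts by zero on `M`. -/
lemma comp_varMul_eq_zero (j : Fin n) {M : GrMod n k} (hM : varMul j M = 0) (i : ℕ) :
    ∀ (N : GrMod n k) (ξ : Abelian.Ext.{u} M N i),
      ξ.comp (Abelian.Ext.mk₀ (varMul j N)) (add_zero i) = 0 := by
  induction i with
  | zero =>
    intro N ξ
    obtain ⟨f, rfl⟩ := (Abelian.Ext.mk₀_bijective M N).2 ξ
    rw [Abelian.Ext.mk₀_comp_mk₀, varMul_naturality, hM, zero_comp, Abelian.Ext.mk₀_zero]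
  | succ i ih =>
    intro N ξ
    -- Dimension shift: with `N` embedded in an injective, `ξ` is some `ζ` of degree `i` followed by
    -- the extension class. Multiplication by `x_j` is natural, hence a morphism from this sequence
    -- to its shift, and it moves past the extension class onto `ζ`.
    let S : ShortComplex (GrMod n k) :=
      ShortComplex.mk (Injective.ι N) (cokernel.π (Injective.ι N)) (cokernel.condition _)
    have hS : S.ShortExact :=
      { exact := ShortComplex.exact_of_g_is_cokernel _ (cokernelIsCokernel (Injective.ι N)) }
    obtain ⟨ζ, rfl⟩ := Abelian.Ext.covariant_sequence_exact₁ M hS ξ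
      (Abelian.Ext.eq_zero_of_injective _) rfl
    let φ : S ⟶ S.map (shiftFunctor n k ⟨1⟩) :=
      { τ₁ := varMul j _
        τ₂ := varMul j _
        τ₃ := varMul j _
        comm₁₂ := (varMul_naturality j _).symm
        comm₂₃ := (varMul_naturality j _).symm }
    have h := ShortComplex.ShortExact.extClass_naturality hS (shortExact_shift hS ⟨1⟩) φ
    change hS.extClass.comp (Abelian.Ext.mk₀ (varMul j N)) (add_zero 1) =
      (Abelian.Ext.mk₀ (varMul j _)).comp _ (zero_add 1) at h
    rw [Abelian.Ext.comp_assoc_of_third_deg_zero, h]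
    exact (Abelian.Ext.comp_assoc_of_second_deg_zero ζ (Abelian.Ext.mk₀ (varMul j _)) _ rfl).symm.trans
      ((congrArg (fun t => Abelian.Ext.comp t _ rfl) (ih _ ζ)).trans (Abelian.Ext.zero_comp _ _ _ _ _))

/-- The map `ι : N ⟶ N'` is multiplication by `x_j` followed by a map `N(1) ⟶ N'`. -/
def VarDivisible (j : Fin n) {N N' : GrMod n k} (ι : N ⟶ N') : Prop :=
  ∃ θ : shift N ⟨1⟩ ⟶ N', varMul j N ≫ θ = ι

lemma VarDivisible.comp_eq_zero {j : Fin n} {N N' : GrMod n k} {ι : N ⟶ N'}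
    (hι : VarDivisible j ι) {M : GrMod n k} (hM : varMul j M = 0) {i : ℕ}
    (ξ : Abelian.Ext.{u} M N i) : ξ.comp (Abelian.Ext.mk₀ ι) (add_zero i) = 0 := by
  obtain ⟨θ, rfl⟩ := hι
  rw [← Abelian.Ext.mk₀_comp_mk₀, ← Abelian.Ext.comp_assoc_of_third_deg_zero,
    comp_varMul_eq_zero j hM, Abelian.Ext.zero_comp]

lemma VarDivisible.shift {j : Fin n} {N N' : GrMod n k} {ι : N ⟶ N'}
    (hι : VarDivisible j ι) (d : Deg n) : VarDivisible j ((shiftFunctor n k d).map ι) := by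
  obtain ⟨θ, rfl⟩ := hι
  -- The monomial `1`, regarded as a morphism between two degrees that are equal but not
  -- definitionally so.
  let σ : ∀ e : Deg n, (⟨d.val + (1 + e.val)⟩ : Deg n) ⟶ ⟨1 + (d.val + e.val)⟩ := fun e =>
    ⟨0, by simp [add_left_comm]⟩
  refine ⟨{ app := fun e => N.map (σ e) ≫ θ.app ⟨d.val + e.val⟩, naturality := ?_ }, ?_⟩
  · intro e e' f
    ext x
    refine (congrArg (θ.app ⟨d.val + e'.val⟩).hom (?_ : _ = _)).trans
      (naturality_apply θ (((Deg.add n).obj d).map f) ((N.map (σ e)).hom x))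
    exact map_map_eq_map_map N _ _ _ _ ((add_zero _).trans (zero_add _).symm) x
  · ext e x
    exact congrArg (θ.app ⟨d.val + e.val⟩).hom
      (map_map_eq_map N _ (σ e) (Deg.mulVar j _) (add_zero _) x)

/-! ### Functoriality and exact sequences of graded `Ext` modules -/

lemma comp_mk₀_comp_mk₀ {M A B C : GrMod n k} {i : ℕ} (x : Abelian.Ext.{u} M A i) (f : A ⟶ B)
    (g : B ⟶ C) (h : A ⟶ C) (w : f ≫ g = h) :
    (x.comp (Abelian.Ext.mk₀ f) (add_zero i)).comp (Abelian.Ext.mk₀ g) (add_zero i) =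
      x.comp (Abelian.Ext.mk₀ h) (add_zero i) := by
  rw [Abelian.Ext.comp_assoc_of_third_deg_zero, Abelian.Ext.mk₀_comp_mk₀, w]

lemma comp_mk₀_comp_mk₀_eq {M A B B' C : GrMod n k} {i : ℕ} (x : Abelian.Ext.{u} M A i)
    (f : A ⟶ B) (g : B ⟶ C) (f' : A ⟶ B') (g' : B' ⟶ C) (w : f ≫ g = f' ≫ g') :
    (x.comp (Abelian.Ext.mk₀ f) (add_zero i)).comp (Abelian.Ext.mk₀ g) (add_zero i) =
      (x.comp (Abelian.Ext.mk₀ f') (add_zero i)).comp (Abelian.Ext.mk₀ g') (add_zero i) :=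
  (comp_mk₀_comp_mk₀ x f g _ w).trans (comp_mk₀_comp_mk₀ x f' g' _ rfl).symm

lemma comp_mk₀_comp_mk₀_of_id {M A B : GrMod n k} {i : ℕ} (x : Abelian.Ext.{u} M A i) (f : A ⟶ B)
    (g : B ⟶ A) (w : f ≫ g = 𝟙 A) :
    (x.comp (Abelian.Ext.mk₀ f) (add_zero i)).comp (Abelian.Ext.mk₀ g) (add_zero i) = x :=
  (comp_mk₀_comp_mk₀ x f g _ w).trans (Abelian.Ext.comp_mk₀_id x)

lemma comp_mk₀_comp_mk₀_of_zero {M A B C : GrMod n k} {i : ℕ} (x : Abelian.Ext.{u} M A i)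
    (f : A ⟶ B) (g : B ⟶ C) (w : f ≫ g = 0) :
    (x.comp (Abelian.Ext.mk₀ f) (add_zero i)).comp (Abelian.Ext.mk₀ g) (add_zero i) = 0 :=
  (comp_mk₀_comp_mk₀ x f g _ w).trans
    (by rw [Abelian.Ext.mk₀_zero, Abelian.Ext.comp_zero])

lemma mk₀_comp_mk₀_comp_of_zero {A B C N : GrMod n k} {i : ℕ} (x : Abelian.Ext.{u} C N i)
    (f : A ⟶ B) (g : B ⟶ C) (w : f ≫ g = 0) :
    (Abelian.Ext.mk₀ f).comp ((Abelian.Ext.mk₀ g).comp x (zero_add i)) (zero_add i) = 0 := by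
  rw [Abelian.Ext.mk₀_comp_mk₀_assoc, w, Abelian.Ext.mk₀_zero, Abelian.Ext.zero_comp]

/-- `gradedExt i M N ⟶ gradedExt i M N'` induced by `N ⟶ N'`. -/
def gradedExtMapRight (i : ℕ) (M : GrMod n k) {N N' : GrMod n k} (φ : N ⟶ N') :
    gradedExt i M N ⟶ gradedExt i M N' where
  app d := ModuleCat.ofHom (Abelian.Ext.postcompOfLinear
    (Abelian.Ext.mk₀ ((shiftFunctor n k d).map φ)) k M (add_zero i))
  naturality d e f := by
    ext x
    refine comp_mk₀_comp_mk₀_eq x (shiftMul N f) ((shiftFunctor n k e).map φ)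
      ((shiftFunctor n k d).map φ) (shiftMul N' f) ?_
    ext e' : 2
    exact φ.naturality (((Deg.add n).map f).app e')

/-- `gradedExt i M N ⟶ gradedExt i M' N` induced by `M' ⟶ M`. -/
def gradedExtMapLeft (i : ℕ) {M M' : GrMod n k} (φ : M' ⟶ M) (N : GrMod n k) :
    gradedExt i M N ⟶ gradedExt i M' N where
  app d := ModuleCat.ofHom ((Abelian.Ext.bilinearCompOfLinear k M' M (shift N d) 0 i i
    (zero_add i)) (Abelian.Ext.mk₀ φ))
  naturality d e f := by
    ext x
    exact (Abelian.Ext.comp_assoc (Abelian.Ext.mk₀ φ) x (Abelian.Ext.mk₀ (shiftMul N f))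
      (zero_add i) (add_zero i) (by simp)).symm

lemma gradedExtMapLeft_app (i : ℕ) {M M' : GrMod n k} (φ : M' ⟶ M) (N : GrMod n k) (d : Deg n)
    (x : Abelian.Ext.{u} M (shift N d) i) :
    ((gradedExtMapLeft i φ N).app d).hom x = (Abelian.Ext.mk₀ φ).comp x (zero_add i) := rfl

instance isIso_gradedExtMapRight (i : ℕ) (M : GrMod n k) {N N' : GrMod n k} (φ : N ⟶ N')
    [IsIso φ] : IsIso (gradedExtMapRight i M φ) := by
  have key : ∀ {P Q : GrMod n k} (a : P ⟶ Q) (b : Q ⟶ P), a ≫ b = 𝟙 P → ∀ d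
      (x : Abelian.Ext.{u} M (shift P d) i), ((gradedExtMapRight i M b).app d).hom
        (((gradedExtMapRight i M a).app d).hom x) = x := by
    intro P Q a b hab d x
    refine comp_mk₀_comp_mk₀_of_id x ((shiftFunctor n k d).map a) ((shiftFunctor n k d).map b) ?_
    rw [← Functor.map_comp, hab, CategoryTheory.Functor.map_id]
    rfl
  refine isIso_of_forall_degree _ fun d => ⟨?_, ?_⟩
  · exact Function.LeftInverse.injective (g := ((gradedExtMapRight i M (inv φ)).app d).hom)
      (key φ (inv φ) (by simp) d)
  · exact Function.RightInverse.surjective (g := ((gradedExtMapRight i M (inv φ)).app d).hom)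
      (key (inv φ) φ (by simp) d)

instance isIso_gradedExtMapLeft (i : ℕ) {M M' : GrMod n k} (φ : M' ⟶ M) (N : GrMod n k)
    [IsIso φ] : IsIso (gradedExtMapLeft i φ N) := by
  have key : ∀ {P Q : GrMod n k} (a : P ⟶ Q) (b : Q ⟶ P), a ≫ b = 𝟙 P → ∀ d
      (x : Abelian.Ext.{u} P (shift N d) i), ((gradedExtMapLeft i a N).app d).hom
        (((gradedExtMapLeft i b N).app d).hom x) = x := by
    intro P Q a b hab d x
    rw [gradedExtMapLeft_app, gradedExtMapLeft_app, Abelian.Ext.mk₀_comp_mk₀_assoc, hab]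
    exact Abelian.Ext.mk₀_id_comp x
  refine isIso_of_forall_degree _ fun d => ⟨?_, ?_⟩
  · exact Function.LeftInverse.injective (g := ((gradedExtMapLeft i (inv φ) N).app d).hom)
      (key (inv φ) φ (by simp) d)
  · exact Function.RightInverse.surjective (g := ((gradedExtMapLeft i (inv φ) N).app d).hom)
      (key φ (inv φ) (by simp) d)

/-- The sequence of `Ext^i` modules in the first variable attached to a short exact sequence. -/
def gradedExtLeftSeq (i : ℕ) (S : ShortComplex (GrMod n k)) (N : GrMod n k) :
    ShortComplex (GrMod n k) :=
  ShortComplex.mk (gradedExtMapLeft i S.g N) (gradedExtMapLeft i S.f N) (by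
    ext d x
    exact mk₀_comp_mk₀_comp_of_zero x S.f S.g S.zero)

/-- Composition with the extension class is the connecting map; once it vanishes in all degrees, the
long exact sequence falls apart into short ones. -/
lemma gradedExtLeftSeq_shortExact {S : ShortComplex (GrMod n k)} (hS : S.ShortExact)
    (N : GrMod n k) (i : ℕ)
    (h : ∀ (j : ℕ) (d : Deg n) (x : Abelian.Ext.{u} S.X₁ (shift N d) j) (j' : ℕ)
      (hj : 1 + j = j'), hS.extClass.comp x hj = 0) :
    (gradedExtLeftSeq i S N).ShortExact := by
  refine shortExact_of_forall_degree _ (fun d => ?_) (fun d x hx => ?_) (fun d x => ?_)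
  · have := hS.epi_g
    refine (injective_iff_map_eq_zero _).2 fun x hx => ?_
    cases i with
    | zero =>
      exact (injective_iff_map_eq_zero _).1
        (Abelian.Ext.precomp_mk₀_injective_of_epi (shift N d) S.g) x hx
    | succ i =>
      obtain ⟨y, rfl⟩ := Abelian.Ext.contravariant_sequence_exact₃ hS (shift N d) x hx
        (add_comm 1 i)
      exact h _ _ _ _ _
  · exact Abelian.Ext.contravariant_sequence_exact₂ hS (shift N d) x hx
  · exact Abelian.Ext.contravariant_sequence_exact₁ hS (shift N d) x rfl (h _ _ _ _ _)

/-- The sequence of `Ext^i` modules in the second variable attached to a short exact sequence. -/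
def gradedExtRightSeq (i : ℕ) (M : GrMod n k) (S : ShortComplex (GrMod n k)) :
    ShortComplex (GrMod n k) :=
  ShortComplex.mk (gradedExtMapRight i M S.f) (gradedExtMapRight i M S.g) (by
    ext d x
    refine comp_mk₀_comp_mk₀_of_zero x ((shiftFunctor n k d).map S.f)
      ((shiftFunctor n k d).map S.g) ?_
    rw [← Functor.map_comp, S.zero, Functor.map_zero])

/-- Here the two neighbouring terms of the long exact sequence, `Ext^(i-1)(M, X₃)` and `Ext^(i+1)(M,
X₁)`, are assumed to vanish. -/
lemma gradedExtRightSeq_shortExact {S : ShortComplex (GrMod n k)} (hS : S.ShortExact)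
    (M : GrMod n k) (i : ℕ)
    (h₃ : ∀ (j : ℕ) (d : Deg n) (x : Abelian.Ext.{u} M (shift S.X₃ d) j), j + 1 = i → x = 0)
    (h₁ : ∀ (d : Deg n) (x : Abelian.Ext.{u} M (shift S.X₁ d) (i + 1)), x = 0) :
    (gradedExtRightSeq i M S).ShortExact := by
  refine shortExact_of_forall_degree _ (fun d => ?_) (fun d x hx => ?_) (fun d x => ?_)
  · have : Mono ((shiftFunctor n k d).map S.f) := (shortExact_shift hS d).mono_f
    refine (injective_iff_map_eq_zero _).2 fun x hx => ?_
    cases i with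
    | zero =>
      exact (injective_iff_map_eq_zero _).1
        (Abelian.Ext.postcomp_mk₀_injective_of_mono M ((shiftFunctor n k d).map S.f)) x hx
    | succ i =>
      obtain ⟨y, rfl⟩ := Abelian.Ext.covariant_sequence_exact₁ M (shortExact_shift hS d) x hx rfl
      have hy : y = 0 := h₃ i d y rfl
      rw [hy, Abelian.Ext.zero_comp]
      rfl
  · exact Abelian.Ext.covariant_sequence_exact₂ M (shortExact_shift hS d) x hx
  · exact Abelian.Ext.covariant_sequence_exact₃ M (shortExact_shift hS d) x rfl (h₁ d _)

lemma VarDivisible.gradedExtMapRight {j : Fin n} {N N' : GrMod n k} {ι : N ⟶ N'}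
    (hι : VarDivisible j ι) (i : ℕ) (M : GrMod n k) :
    VarDivisible j (gradedExtMapRight i M ι) := by
  obtain ⟨θ, rfl⟩ := hι
  let σ : ∀ d e : Deg n, (⟨1 + d.val + e.val⟩ : Deg n) ⟶ ⟨1 + (d.val + e.val)⟩ := fun d e =>
    ⟨0, by simp [add_assoc]⟩
  let ψ : ∀ d : Deg n, GradedReg.shift N ⟨1 + d.val⟩ ⟶ GradedReg.shift N' d := fun d =>
    { app := fun e => N.map (σ d e) ≫ θ.app ⟨d.val + e.val⟩
      naturality := fun e e' f => by
        ext x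
        refine (congrArg (θ.app ⟨d.val + e'.val⟩).hom (?_ : _ = _)).trans
          (naturality_apply θ (((Deg.add n).obj d).map f) ((N.map (σ d e)).hom x))
        exact map_map_eq_map_map N _ _ _ _ ((add_zero _).trans (zero_add _).symm) x }
  refine ⟨{ app := fun d => ModuleCat.ofHom (Abelian.Ext.postcompOfLinear
    (Abelian.Ext.mk₀ (ψ d)) k M (add_zero i)), naturality := ?_ }, ?_⟩
  · intro d d' f
    ext x
    let f' : (⟨1 + d.val⟩ : Deg n) ⟶ ⟨1 + d'.val⟩ := ((Deg.add n).obj ⟨1⟩).map f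
    refine comp_mk₀_comp_mk₀_eq x (shiftMul N f') (ψ d') (ψ d) (shiftMul N' f) ?_
    ext e y
    refine (congrArg (θ.app ⟨d'.val + e.val⟩).hom (?_ : _ = _)).trans
      (naturality_apply θ (((Deg.add n).map f).app e) ((N.map (σ d e)).hom y))
    exact map_map_eq_map_map N _ _ _ _ ((add_zero _).trans (zero_add _).symm) y
  · ext d x
    let f' : d ⟶ (⟨1 + d.val⟩ : Deg n) := Deg.mulVar j d
    refine comp_mk₀_comp_mk₀ x (shiftMul N f') (ψ d) ((shiftFunctor n k d).map _) ?_
    ext e y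
    exact congrArg (θ.app ⟨d.val + e.val⟩).hom
      (map_map_eq_map N _ (σ d e) (Deg.mulVar j _) (add_zero _) y)

/-! ### Graded modules with a basis of monomials -/

/-- The exponent vector of a monomial, with integer entries. -/
def expVec (a : Fin n →₀ ℕ) : Fin n → ℤ := fun j => (a j : ℤ)

lemma expVec_add (a b : Fin n →₀ ℕ) : expVec (a + b) = expVec a + expVec b := by
  ext j; simp [expVec]

lemma expVec_nonneg (a : Fin n →₀ ℕ) : 0 ≤ expVec a := fun _ => Int.natCast_nonneg _

lemma expVec_injective : Function.Injective (expVec (n := n)) := fun a b h => by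
  ext j
  exact Int.ofNat_injective (congrFun h j)

lemma sum_expVec (a : Fin n →₀ ℕ) : ∑ j, expVec a j = (a.degree : ℤ) := by
  simp [expVec, Finsupp.degree_eq_sum]

lemma exists_expVec_eq {v : Fin n → ℤ} (hv : 0 ≤ v) : ∃ a : Fin n →₀ ℕ, expVec a = v :=
  ⟨Finsupp.equivFunOnFinite.symm fun j => (v j).toNat, funext fun j => by
    simpa [expVec] using hv j⟩

lemma expVec_single (j : Fin n) : expVec (Finsupp.single j 1) = Pi.single j 1 := by
  ext i
  by_cases h : i = j
  · subst h; simp [expVec]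
  · simp [expVec, h]

/-- Functions supported on the elements of `B` of degree `d`, where the degree of `c` is
`∑ c_j + s`. -/
def monomialPart (k : Type u) [Field k] (B : Set (Fin n → ℤ)) (s d : ℤ) :
    Submodule k ((Fin n → ℤ) → k) where
  carrier := {φ | ∀ c, φ c ≠ 0 → c ∈ B ∧ ∑ j, c j + s = d}
  zero_mem' c h := absurd rfl h
  add_mem' {φ ψ} hφ hψ c h := by
    by_cases h0 : φ c = 0
    · exact hψ c fun h1 => h (by simp [h0, h1])
    · exact hφ c h0
  smul_mem' r φ hφ c h := hφ c fun h0 => h (by simp [h0])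

open Classical in
/-- Translation of functions by `v`, followed by restriction to `B`. -/
def translate (k : Type u) [Field k] (B : Set (Fin n → ℤ)) (v : Fin n → ℤ) :
    ((Fin n → ℤ) → k) →ₗ[k] ((Fin n → ℤ) → k) where
  toFun φ c := if c ∈ B then φ (c - v) else 0
  map_add' φ ψ := by ext c; by_cases h : c ∈ B <;> simp [h]
  map_smul' r φ := by ext c; by_cases h : c ∈ B <;> simp [h]

lemma translate_of_mem {B : Set (Fin n → ℤ)} {c : Fin n → ℤ} (h : c ∈ B) (v : Fin n → ℤ)
    (φ : (Fin n → ℤ) → k) : translate k B v φ c = φ (c - v) := if_pos h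

lemma translate_of_notMem {B : Set (Fin n → ℤ)} {c : Fin n → ℤ} (h : c ∉ B) (v : Fin n → ℤ)
    (φ : (Fin n → ℤ) → k) : translate k B v φ c = 0 := if_neg h

lemma eq_zero_of_notMem {B : Set (Fin n → ℤ)} {s d : ℤ} {φ : (Fin n → ℤ) → k}
    (hφ : φ ∈ monomialPart k B s d) {c : Fin n → ℤ} (hc : c ∉ B) : φ c = 0 := by
  by_contra h
  exact hc (hφ c h).1

lemma translate_mem {B B' : Set (Fin n → ℤ)} {s s' d d' : ℤ} {v : Fin n → ℤ}
    (h : d + ∑ j, v j + s' = d' + s) {φ : (Fin n → ℤ) → k} (hφ : φ ∈ monomialPart k B s d) :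
    translate k B' v φ ∈ monomialPart k B' s' d' := by
  intro c hc
  by_cases hB : c ∈ B'
  · rw [translate_of_mem hB] at hc
    have := (hφ _ hc).2
    simp only [Pi.sub_apply, Finset.sum_sub_distrib] at this
    exact ⟨hB, by linarith⟩
  · exact absurd (translate_of_notMem hB v φ) hc

/-- Two translations compose to a translation. -/
lemma translate_translate {B B' B'' : Set (Fin n → ℤ)} {s d : ℤ} {v w : Fin n → ℤ}
    {φ : (Fin n → ℤ) → k} (hφ : φ ∈ monomialPart k B s d)
    (h : ∀ c ∈ B'', c - w - v ∈ B → c - w ∈ B') :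
    translate k B'' w (translate k B' v φ) = translate k B'' (v + w) φ := by
  ext c
  by_cases hc : c ∈ B''
  · rw [translate_of_mem hc, translate_of_mem hc, add_comm v w, ← sub_sub]
    by_cases h0 : c - w - v ∈ B
    · rw [translate_of_mem (h c hc h0)]
    · rw [eq_zero_of_notMem hφ h0]
      by_cases h1 : c - w ∈ B'
      · rw [translate_of_mem h1, eq_zero_of_notMem hφ h0]
      · rw [translate_of_notMem h1]
  · rw [translate_of_notMem hc, translate_of_notMem hc]

lemma translate_zero {B : Set (Fin n → ℤ)} {s d : ℤ}
    {φ : (Fin n → ℤ) → k} (hφ : φ ∈ monomialPart k B s d) : translate k B 0 φ = φ := by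
  ext c
  by_cases hc : c ∈ B
  · rw [translate_of_mem hc, sub_zero]
  · rw [translate_of_notMem hc, eq_zero_of_notMem hφ hc]

/-- The graded module with a basis of monomials indexed by the order-connected set `B`, the
degree of the monomial indexed by `c` being `∑ c_j + s`. -/
def monomialModule (k : Type u) [Field k] (B : Set (Fin n → ℤ)) [hB : B.OrdConnected] (s : ℤ) :
    GrMod n k where
  obj d := ModuleCat.of k (monomialPart k B s d.val)
  map {d e} f := ModuleCat.ofHom ((translate k B (expVec f.exp)).restrict
    (p := monomialPart k B s d.val) (q := monomialPart k B s e.val)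
    (fun _ hφ => translate_mem (by rw [sum_expVec, f.deg_eq]) hφ))
  map_id d := by
    exact ModuleCat.hom_ext (LinearMap.ext fun x => Subtype.ext (translate_zero x.2))
  map_comp {d e e'} f g := by
    refine ModuleCat.hom_ext (LinearMap.ext fun x => Subtype.ext
      ((congrArg (fun v => translate k B v x.1) (expVec_add f.exp g.exp)).trans
      (translate_translate x.2 fun c hc h => ?_).symm))
    -- Order-connectedness is what makes the action associative: a product of monomials that starts
    -- and ends in `B` cannot leave `B` in between.
    exact hB.out h hc ⟨sub_le_self _ (expVec_nonneg _), sub_le_self _ (expVec_nonneg _)⟩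

section

variable {B B' : Set (Fin n → ℤ)} [hB : B.OrdConnected] [hB' : B'.OrdConnected]

/-- The function underlying an element of a graded module with a basis of monomials. -/
def coeffFun {s : ℤ} {d : Deg n} (x : (monomialModule k B s).obj d) : (Fin n → ℤ) → k :=
  (show monomialPart k B s d.val from x).1

lemma coeffFun_mem {s : ℤ} {d : Deg n} (x : (monomialModule k B s).obj d) :
    coeffFun x ∈ monomialPart k B s d.val :=
  (show monomialPart k B s d.val from x).2

lemma coeffFun_ext {s : ℤ} {d : Deg n} {x y : (monomialModule k B s).obj d}
    (h : coeffFun x = coeffFun y) : x = y := Subtype.ext h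

/-- The element with a given underlying function. -/
def ofCoeffFun {s : ℤ} {d : Deg n} (φ : (Fin n → ℤ) → k) (hφ : φ ∈ monomialPart k B s d.val) :
    (monomialModule k B s).obj d :=
  (⟨φ, hφ⟩ : monomialPart k B s d.val)

lemma coeffFun_map {s : ℤ} {d e : Deg n} (f : d ⟶ e) (x : (monomialModule k B s).obj d) :
    coeffFun (((monomialModule k B s).map f).hom x) = translate k B (expVec f.exp) (coeffFun x) :=
  rfl

/-- The inclusion or restriction map between modules with monomial bases. -/
def monomialMap (k : Type u) [Field k] (B B' : Set (Fin n → ℤ)) [hB : B.OrdConnected]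
    [hB' : B'.OrdConnected] (s : ℤ) (h : ∀ c ∈ B, ∀ c' ∈ B', c ≤ c' → c' ∈ B ∧ c ∈ B') :
    monomialModule k B s ⟶ monomialModule k B' s where
  app d := ModuleCat.ofHom ((translate k B' 0).restrict
    (p := monomialPart k B s d.val) (q := monomialPart k B' s d.val)
    (fun _ hφ => translate_mem (by simp) hφ))
  naturality d e f := by
    refine ModuleCat.hom_ext (LinearMap.ext fun x => Subtype.ext
      (((translate_translate (B'' := B') x.2 fun c hc h0 => ?_).trans
      (congrArg (fun v => translate k B' v x.1) (add_comm (expVec f.exp) 0))).trans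
      (translate_translate (B'' := B') x.2 fun c hc h0 => ?_).symm))
    · rw [sub_zero] at h0 ⊢
      exact (h _ h0 _ hc (sub_le_self _ (expVec_nonneg _))).1
    · rw [sub_zero] at h0
      exact (h _ h0 _ hc (sub_le_self _ (expVec_nonneg _))).2

/-- The short exact sequence obtained by splitting a set of monomials into an upper part `B₁` and
a lower part `B₂`. -/
def splitSeq (k : Type u) [Field k] (B₁ B B₂ : Set (Fin n → ℤ)) [B₁.OrdConnected]
    [B.OrdConnected] [B₂.OrdConnected] (s : ℤ) (hB : ∀ c, c ∈ B ↔ c ∈ B₁ ∨ c ∈ B₂)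
    (hd : ∀ c ∈ B₁, ∀ c' ∈ B₂, ¬ c ≤ c') (hu : ∀ c ∈ B₁, ∀ c' ∈ B, c ≤ c' → c' ∈ B₁) :
    ShortComplex (GrMod n k) :=
  ShortComplex.mk
    (monomialMap k B₁ B s fun c hc c' hc' h => ⟨hu c hc c' hc' h, (hB c).2 (Or.inl hc)⟩)
    (monomialMap k B B₂ s fun c hc c' hc' h => ⟨(hB c').2 (Or.inr hc'),
      ((hB c).1 hc).resolve_left fun h1 => hd c h1 c' hc' h⟩) (by
    ext d x
    refine coeffFun_ext (funext fun c => ?_)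
    change translate k B₂ 0 (translate k B 0 (coeffFun x)) c = 0
    by_cases hc : c ∈ B₂
    · rw [translate_of_mem hc, translate_of_mem (by rw [sub_zero]; exact (hB c).2 (Or.inr hc)),
        sub_zero, sub_zero]
      exact eq_zero_of_notMem (coeffFun_mem x) fun h => hd c h c hc le_rfl
    · exact translate_of_notMem hc _ _)

lemma splitSeq_shortExact (B₁ B B₂ : Set (Fin n → ℤ)) [B₁.OrdConnected]
    [B.OrdConnected] [B₂.OrdConnected] (s : ℤ) (hB : ∀ c, c ∈ B ↔ c ∈ B₁ ∨ c ∈ B₂)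
    (hd : ∀ c ∈ B₁, ∀ c' ∈ B₂, ¬ c ≤ c') (hu : ∀ c ∈ B₁, ∀ c' ∈ B, c ≤ c' → c' ∈ B₁) :
    (splitSeq k B₁ B B₂ s hB hd hu).ShortExact := by
  have key : ∀ {d : Deg n} (x : (monomialModule k B₁ s).obj d) (c : Fin n → ℤ),
      translate k B 0 (coeffFun x) c = coeffFun x c := fun x c => by
    by_cases hc : c ∈ B
    · rw [translate_of_mem hc, sub_zero]
    · rw [translate_of_notMem hc, eq_zero_of_notMem (coeffFun_mem x)
        fun h => hc ((hB c).2 (Or.inl h))]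
  have key2 : ∀ {d : Deg n} (x : (monomialModule k B s).obj d) (c : Fin n → ℤ), c ∈ B₂ →
      translate k B₂ 0 (coeffFun x) c = coeffFun x c := fun x c hc => by
    rw [translate_of_mem hc, sub_zero]
  refine shortExact_of_forall_degree _ (fun d x y hxy => ?_) (fun d x hx => ?_) (fun d x => ?_)
  · refine coeffFun_ext (funext fun c => ?_)
    exact (key x c).symm.trans ((congrFun (congrArg coeffFun hxy) c).trans (key y c))
  · have hmem : coeffFun (B := B) (s := s) x ∈ monomialPart k B₁ s d.val := fun c hc => by
      have h1 := coeffFun_mem (B := B) (s := s) x c hc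
      refine ⟨((hB c).1 h1.1).resolve_right fun h2 => hc ?_, h1.2⟩
      exact (key2 x c h2).symm.trans (congrFun (congrArg coeffFun hx) c)
    exact ⟨ofCoeffFun _ hmem, coeffFun_ext (funext fun c => key (ofCoeffFun (d := d) _ hmem) c)⟩
  · refine ⟨ofCoeffFun (B := B) (s := s) (coeffFun x) fun c hc => ?_,
      coeffFun_ext (funext fun c => ?_)⟩
    · have h1 := coeffFun_mem x c hc
      exact ⟨(hB c).2 (Or.inr h1.1), h1.2⟩
    · change translate k B₂ 0 (coeffFun x) c = coeffFun x c
      exact congrFun (translate_zero (coeffFun_mem x)) c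

/-! ### Maps out of modules with monomial bases -/

instance (d e : Deg n) : Finite (d ⟶ e) := by
  have := (Finsupp.finite_of_degree_le (σ := Fin n) (e.val - d.val).toNat).to_subtype
  have h : ∀ f : d ⟶ e, f.exp.degree ≤ (e.val - d.val).toNat := fun f => by
    have := f.deg_eq
    omega
  exact Finite.of_injective (β := {a : Fin n →₀ ℕ | a.degree ≤ (e.val - d.val).toNat})
    (fun f => ⟨f.exp, h f⟩) fun f g h => Deg.Hom.ext (congrArg Subtype.val h)

instance (d e : Deg n) : Fintype (d ⟶ e) := Fintype.ofFinite _

/-- The map to `N` sending the monomial with exponent vector `u` to `y`. -/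
def monomialDesc {B : Set (Fin n → ℤ)} [B.OrdConnected] {s : ℤ} {u : Fin n → ℤ} {d₀ : Deg n}
    (hBu : ∀ c ∈ B, u ≤ c) {N : GrMod n k} (y : N.obj d₀)
    (hy : ∀ (e : Deg n) (f : d₀ ⟶ e), u + expVec f.exp ∉ B → (N.map f).hom y = 0) :
    monomialModule k B s ⟶ N where
  app d := ModuleCat.ofHom
    { toFun := fun x => ∑ f : d₀ ⟶ d, coeffFun x (u + expVec f.exp) • (N.map f).hom y
      map_add' := fun x z => by
        rw [← Finset.sum_add_distrib]
        exact Finset.sum_congr rfl fun f _ => add_smul _ _ _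
      map_smul' := fun r x => by
        rw [Finset.smul_sum]
        exact Finset.sum_congr rfl fun f _ => mul_smul _ _ _ }
  naturality d e g := by
    ext x
    change ∑ f : d₀ ⟶ e, translate k B (expVec g.exp) (coeffFun x) (u + expVec f.exp) •
        (N.map f).hom y =
      (N.map g).hom (∑ f : d₀ ⟶ d, coeffFun x (u + expVec f.exp) • (N.map f).hom y)
    rw [map_sum]
    symm
    -- The terms on the right are indexed by the multiples of `g` among the monomials on the left.
    -- Any other `f` contributes zero: either `u + f` is outside `B`, where `y` is killed, or `u + f
    -- - g` is not above `u`, hence outside `B`.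
    refine Finset.sum_of_injOn (fun f => f ≫ g) ?_ (fun _ _ => Finset.mem_coe.2 (Finset.mem_univ _))
      ?_ ?_
    · intro f _ f' _ h
      exact Deg.Hom.ext (add_right_cancel (congrArg Deg.Hom.exp h : f.exp + g.exp = f'.exp + g.exp))
    · intro f _ hf
      by_cases hB : u + expVec f.exp ∈ B
      · rw [translate_of_mem hB]
        have : u + expVec f.exp - expVec g.exp ∉ B := by
          intro h
          have h1 : 0 ≤ expVec f.exp - expVec g.exp := by
            have := hBu _ h
            rw [add_sub_assoc] at this
            exact le_of_add_le_add_left ((add_zero u).le.trans this)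
          obtain ⟨a, ha⟩ := exists_expVec_eq h1
          have h2 : a + g.exp = f.exp := expVec_injective (by rw [expVec_add, ha]; abel)
          refine hf ⟨⟨a, ?_⟩, Finset.mem_coe.2 (Finset.mem_univ _), Deg.Hom.ext h2⟩
          have h3 := f.deg_eq
          have h4 := g.deg_eq
          rw [← h2, map_add] at h3
          push_cast at h3
          linarith
        rw [eq_zero_of_notMem (coeffFun_mem x) this, zero_smul]
      · rw [hy _ _ hB, smul_zero]
    · intro f _
      have h1 : (f ≫ g).exp = f.exp + g.exp := rfl
      by_cases hB : u + expVec (f ≫ g).exp ∈ B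
      · rw [translate_of_mem hB, map_smul, map_comp_apply, h1, expVec_add, ← add_assoc,
          add_sub_cancel_right]
      · rw [hy _ _ hB, smul_zero, map_smul, ← map_comp_apply, hy _ _ hB, smul_zero]

open Classical in
/-- The basis element with exponent vector `u`. -/
def basisElt (k : Type u) [Field k] {B : Set (Fin n → ℤ)} [B.OrdConnected] {s : ℤ} {u : Fin n → ℤ}
    (hu : u ∈ B) {d₀ : Deg n} (hd₀ : ∑ j, u j + s = d₀.val) : (monomialModule k B s).obj d₀ :=
  ofCoeffFun (Pi.single u 1) fun c hc => by
    by_cases h : c = u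
    · subst h
      exact ⟨hu, hd₀⟩
    · simp [h] at hc

lemma monomialDesc_basisElt {B : Set (Fin n → ℤ)} [B.OrdConnected] {s : ℤ} {u : Fin n → ℤ}
    {d₀ : Deg n} (hu : u ∈ B) (hBu : ∀ c ∈ B, u ≤ c) (hd₀ : ∑ j, u j + s = d₀.val)
    {N : GrMod n k} (y : N.obj d₀)
    (hy : ∀ (e : Deg n) (f : d₀ ⟶ e), u + expVec f.exp ∉ B → (N.map f).hom y = 0) :
    ((monomialDesc hBu y hy).app d₀).hom (basisElt k hu hd₀) = y := by
  classical
  change ∑ f : d₀ ⟶ d₀, coeffFun (basisElt k hu hd₀) (u + expVec f.exp) • (N.map f).hom y = y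
  rw [Finset.sum_eq_single (𝟙 d₀)]
  · rw [map_id_apply]
    have : coeffFun (basisElt k hu hd₀) (u + expVec (𝟙 d₀ : d₀ ⟶ d₀).exp) = 1 := by
      change Pi.single (M := fun _ => k) u 1 (u + 0) = 1
      simp
    rw [this, one_smul]
  · intro f _ hf
    have : coeffFun (basisElt k hu hd₀) (u + expVec f.exp) = 0 := by
      refine Pi.single_eq_of_ne (M := fun _ => k) (fun h => hf (Deg.Hom.ext ?_)) 1
      exact expVec_injective (add_eq_left.1 h)
    rw [this, zero_smul]
  · exact fun h => absurd (Finset.mem_univ _) h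

lemma map_basisElt_eq_zero {B : Set (Fin n → ℤ)} [B.OrdConnected] {s : ℤ} {u : Fin n → ℤ}
    {d₀ e : Deg n} (hu : u ∈ B) (hd₀ : ∑ j, u j + s = d₀.val) (f : d₀ ⟶ e)
    (hf : u + expVec f.exp ∉ B) :
    ((monomialModule k B s).map f).hom (basisElt k hu hd₀) = 0 := by
  classical
  refine coeffFun_ext (funext fun c => ?_)
  rw [coeffFun_map]
  by_cases hc : c ∈ B
  · rw [translate_of_mem hc]
    refine Pi.single_eq_of_ne (M := fun _ => k) (fun h => hf ?_) 1
    rwa [← h, sub_add_cancel]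
  · exact translate_of_notMem hc _ _

/-- A map out of a module with monomial basis is determined by the image of the smallest
monomial. -/
lemma app_eq_sum {B : Set (Fin n → ℤ)} [B.OrdConnected] {s : ℤ} {u : Fin n → ℤ}
    {d₀ : Deg n} (hu : u ∈ B) (hBu : ∀ c ∈ B, u ≤ c) (hd₀ : ∑ j, u j + s = d₀.val)
    {N : GrMod n k} (ψ : monomialModule k B s ⟶ N) (d : Deg n)
    (x : (monomialModule k B s).obj d) :
    (ψ.app d).hom x = ∑ f : d₀ ⟶ d, coeffFun x (u + expVec f.exp) •
      (N.map f).hom ((ψ.app d₀).hom (basisElt k hu hd₀)) := by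
  classical
  have hx : x = ∑ f : d₀ ⟶ d, coeffFun x (u + expVec f.exp) •
      ((monomialModule k B s).map f).hom (basisElt k hu hd₀) := by
    let L : (monomialModule k B s).obj d →ₗ[k] ((Fin n → ℤ) → k) :=
      (monomialPart k B s d.val).subtype
    refine coeffFun_ext ?_
    change L x = L _
    rw [map_sum]
    ext c
    rw [Finset.sum_apply]
    change coeffFun x c = ∑ f : d₀ ⟶ d, coeffFun x (u + expVec f.exp) *
      translate k B (expVec f.exp) (Pi.single u 1) c
    by_cases hc : c ∈ B ∧ ∑ j, c j + s = d.val
    · obtain ⟨a, ha⟩ := exists_expVec_eq (sub_nonneg.2 (hBu c hc.1))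
      have hac : c = u + expVec a := by rw [ha]; abel
      let f₀ : d₀ ⟶ d := ⟨a, by
        rw [← hd₀, ← hc.2, ← sum_expVec, hac]
        simp only [Pi.add_apply, Finset.sum_add_distrib]
        ring⟩
      rw [Finset.sum_eq_single f₀]
      · rw [translate_of_mem hc.1]
        change _ = coeffFun x (u + expVec a) * Pi.single (M := fun _ => k) u 1 (c - expVec a)
        rw [hac, add_sub_cancel_right, Pi.single_eq_same, mul_one]
      · intro f _ hf
        rw [translate_of_mem hc.1, Pi.single_eq_of_ne (M := fun _ => k), mul_zero]
        intro h
        refine hf (Deg.Hom.ext (expVec_injective ?_))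
        change expVec f.exp = expVec a
        rw [ha, ← h]
        abel
      · exact fun h => absurd (Finset.mem_univ _) h
    · have h0 : coeffFun x c = 0 := by
        by_contra h
        exact hc (coeffFun_mem x c h)
      rw [h0]
      refine (Finset.sum_eq_zero fun f _ => ?_).symm
      by_cases hcB : c ∈ B
      · rw [translate_of_mem hcB]
        by_cases h1 : c - expVec f.exp = u
        · rw [← h1, sub_add_cancel, h0, zero_mul]
        · rw [Pi.single_eq_of_ne (M := fun _ => k) h1, mul_zero]
      · rw [translate_of_notMem hcB, mul_zero]
  conv_lhs => rw [hx]
  rw [map_sum]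
  refine Finset.sum_congr rfl fun f _ => ?_
  rw [map_smul, naturality_apply]

lemma hom_ext_of_basisElt {B : Set (Fin n → ℤ)} [B.OrdConnected] {s : ℤ} {u : Fin n → ℤ}
    {d₀ : Deg n} (hu : u ∈ B) (hBu : ∀ c ∈ B, u ≤ c) (hd₀ : ∑ j, u j + s = d₀.val)
    {N : GrMod n k} {ψ ψ' : monomialModule k B s ⟶ N}
    (h : (ψ.app d₀).hom (basisElt k hu hd₀) = (ψ'.app d₀).hom (basisElt k hu hd₀)) : ψ = ψ' := by
  ext d x
  refine (app_eq_sum hu hBu hd₀ ψ d x).trans (Eq.trans ?_ (app_eq_sum hu hBu hd₀ ψ' d x).symm)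
  rw [h]

/-- The free module of rank one is projective. -/
lemma projective_monomialModule {B : Set (Fin n → ℤ)} [B.OrdConnected] (u : Fin n → ℤ)
    (hB : ∀ c, c ∈ B ↔ u ≤ c) (s : ℤ) : Projective (monomialModule k B s) where
  factors {E X} f e _ := by
    let d₀ : Deg n := ⟨∑ j, u j + s⟩
    have hu : u ∈ B := (hB u).2 le_rfl
    have hBu : ∀ c ∈ B, u ≤ c := fun c => (hB c).1
    obtain ⟨y, hy⟩ := surjective_app e d₀ ((f.app d₀).hom (basisElt k hu rfl))
    refine ⟨monomialDesc hBu (d₀ := d₀) y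
      fun _ g h => absurd ((hB _).2 (le_add_of_nonneg_right (expVec_nonneg g.exp))) h,
      hom_ext_of_basisElt hu hBu (d₀ := d₀) rfl ?_⟩
    change (e.app d₀).hom _ = _
    rw [← hy]
    exact congrArg (e.app d₀).hom (monomialDesc_basisElt hu hBu rfl y _)

end

/-! ### Cones, and the vanishing of `Ext` between the corresponding modules -/

/-- The exponent vectors which agree with `u` on `S` and are at least `u` elsewhere. The
corresponding module is `(R/(x_j : j ∈ S))(-u)`. -/
def cone (S : Finset (Fin n)) (u : Fin n → ℤ) : Set (Fin n → ℤ) :=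
  {c | u ≤ c ∧ ∀ j ∈ S, c j = u j}

instance (S : Finset (Fin n)) (u : Fin n → ℤ) : (cone S u).OrdConnected where
  out' _ hx _ hy _ hz := ⟨hx.1.trans hz.1, fun j hj =>
    le_antisymm ((hz.2 j).trans (hy.2 j hj).le) (hx.1.trans hz.1 j)⟩

lemma mem_cone_self (S : Finset (Fin n)) (u : Fin n → ℤ) : u ∈ cone S u := ⟨le_rfl, fun _ _ => rfl⟩

lemma mem_cone_univ {u c : Fin n → ℤ} : c ∈ cone Finset.univ u ↔ c = u :=
  ⟨fun h => funext fun j => h.2 j (Finset.mem_univ j), fun h => h ▸ mem_cone_self _ _⟩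

/-- The module with monomial basis indexed by a cone. -/
abbrev coneModule (k : Type u) [Field k] (S : Finset (Fin n)) (u : Fin n → ℤ) (s : ℤ) : GrMod n k :=
  monomialModule k (cone S u) s

lemma add_single_le_iff {u c : Fin n → ℤ} {j : Fin n} :
    u + Pi.single j 1 ≤ c ↔ u ≤ c ∧ c j ≠ u j := by
  constructor
  · intro h
    have hj : u j + 1 ≤ c j := by simpa using h j
    refine ⟨fun i => ?_, by omega⟩
    by_cases hi : i = j
    · subst hi
      exact (lt_add_one _).le.trans hj
    · simpa [hi] using h i
  · rintro ⟨h, hj⟩ i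
    by_cases hi : i = j
    · subst hi
      simpa using Int.add_one_le_of_lt (lt_of_le_of_ne (h i) hj.symm)
    · simpa [hi] using h i

lemma mem_cone_add_single {S : Finset (Fin n)} {u : Fin n → ℤ} {j : Fin n} (hj : j ∉ S)
    {c : Fin n → ℤ} : c ∈ cone S (u + Pi.single j 1) ↔ c ∈ cone S u ∧ c j ≠ u j := by
  have : ∀ i ∈ S, (u + Pi.single j 1 : Fin n → ℤ) i = u i := fun i hi => by
    have : i ≠ j := fun h => hj (h ▸ hi)
    simp [this]
  constructor
  · rintro ⟨h, h'⟩
    rw [add_single_le_iff] at h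
    exact ⟨⟨h.1, fun i hi => (h' i hi).trans (this i hi)⟩, h.2⟩
  · rintro ⟨⟨h, h'⟩, h2⟩
    exact ⟨add_single_le_iff.2 ⟨h, h2⟩, fun i hi => (h' i hi).trans (this i hi).symm⟩

lemma mem_cone_insert {S : Finset (Fin n)} {u : Fin n → ℤ} {j : Fin n}
    {c : Fin n → ℤ} : c ∈ cone (insert j S) u ↔ c ∈ cone S u ∧ c j = u j := by
  simp only [cone, Set.mem_ofPred_eq, Finset.forall_mem_insert]
  tauto

/-- The short exact sequence given by multiplication by `x_j` on `R/(x_i : i ∈ S)`. -/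
def coneSeq (k : Type u) [Field k] {S : Finset (Fin n)} {j : Fin n} (hj : j ∉ S) (u : Fin n → ℤ)
    (s : ℤ) : ShortComplex (GrMod n k) :=
  splitSeq k (cone S (u + Pi.single j 1)) (cone S u) (cone (insert j S) u) s
    (fun c => by rw [mem_cone_add_single hj, mem_cone_insert]; tauto)
    (fun c hc c' hc' h => by
      rw [mem_cone_add_single hj] at hc
      rw [mem_cone_insert] at hc'
      exact hc.2 (le_antisymm ((h j).trans hc'.2.le) (hc.1.1 j)))
    (fun c hc c' hc' h => by
      rw [mem_cone_add_single hj] at hc ⊢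
      refine ⟨hc', fun h' => hc.2 (le_antisymm ((h j).trans h'.le) (hc.1.1 j))⟩)

lemma coneSeq_shortExact {S : Finset (Fin n)} {j : Fin n} (hj : j ∉ S) (u : Fin n → ℤ)
    (s : ℤ) : (coneSeq k hj u s).ShortExact := splitSeq_shortExact _ _ _ _ _ _ _

lemma sub_single_mem_cone {S : Finset (Fin n)} {j : Fin n} {u c : Fin n → ℤ} :
    c - Pi.single j 1 ∈ cone S u ↔ c ∈ cone S (u + Pi.single j 1) := by
  simp only [cone, Set.mem_ofPred_eq, le_sub_iff_add_le, Pi.sub_apply, Pi.add_apply,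
    sub_eq_iff_eq_add]

/-- Translation by `-e_j` identifies the shift by `1` of the module of the cone at `u + e_j` with
the module of the cone at `u`; under it the inclusion of cones is multiplication by `x_j`. -/
lemma varDivisible_coneSeq {S : Finset (Fin n)} {j : Fin n} (hj : j ∉ S) (u : Fin n → ℤ)
    (s : ℤ) : VarDivisible j (coneSeq k hj u s).f := by
  let B := cone S (u + Pi.single j 1)
  let B' := cone S u
  have hBB' : ∀ c, c + Pi.single j 1 ∈ B ↔ c ∈ B' := fun c => by
    rw [← sub_single_mem_cone, add_sub_cancel_right]
  refine ⟨{ app := fun d => ModuleCat.ofHom ((translate k B' (-Pi.single j 1)).restrict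
      (p := monomialPart k B s (1 + d.val)) (q := monomialPart k B' s d.val)
      (fun _ hφ => translate_mem ?_ hφ)), naturality := ?_ }, ?_⟩
  · simp
  · intro d e f
    refine ModuleCat.hom_ext (LinearMap.ext fun x => Subtype.ext
      (((translate_translate (B := B) (B' := B) (B'' := B') (s := s) (d := 1 + d.val)
        (v := expVec f.exp) (w := -Pi.single j 1) (coeffFun_mem x) fun c hc h0 => ?_).trans
      (congrArg (fun v => translate k B' v (coeffFun x)) (add_comm _ _))).trans
      (translate_translate (B := B) (B' := B') (B'' := B') (s := s) (d := 1 + d.val)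
        (v := -Pi.single j 1) (w := expVec f.exp) (coeffFun_mem x) fun c hc h0 => ?_).symm))
    · rwa [sub_neg_eq_add, hBB']
    · rwa [sub_neg_eq_add, hBB'] at h0
  · ext d x
    refine coeffFun_ext ((translate_translate (B := B) (B' := B) (B'' := B') (s := s) (d := d.val)
        (v := expVec (Finsupp.single j 1)) (w := -Pi.single j 1) (coeffFun_mem x)
        fun c hc h0 => ?_).trans
      (congrArg (fun v => translate k B' v (coeffFun x)) ?_))
    · rwa [sub_neg_eq_add, hBB']
    · rw [expVec_single, add_neg_cancel]

lemma varMul_coneModule {S : Finset (Fin n)} {j : Fin n} (hj : j ∈ S) (u : Fin n → ℤ)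
    (s : ℤ) : varMul j (coneModule k S u s) = 0 := by
  ext d x
  refine coeffFun_ext (B := cone S u) (s := s) (d := ⟨1 + d.val⟩) (funext fun c => ?_)
  change translate k (cone S u) (expVec (Finsupp.single j 1)) (coeffFun x) c = 0
  rw [expVec_single]
  by_cases hc : c ∈ cone S u
  · rw [translate_of_mem hc]
    refine eq_zero_of_notMem (coeffFun_mem x) fun h => ?_
    have h1 := h.2 j hj
    have h2 := hc.2 j hj
    simp only [Pi.sub_apply, Pi.single_eq_same] at h1
    omega
  · exact translate_of_notMem hc _ _

lemma ext_eq_zero_of_forall_eq_zero {S : ShortComplex (GrMod n k)} (hS : S.ShortExact)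
    (N : GrMod n k) {i : ℕ} (h₁ : ∀ i', 1 + i' = i → ∀ ξ : Abelian.Ext.{u} S.X₁ N i', ξ = 0)
    (h₂ : ∀ ξ : Abelian.Ext.{u} S.X₂ N i, ξ = 0) (ξ : Abelian.Ext.{u} S.X₃ N i) : ξ = 0 := by
  have := hS.epi_g
  cases i with
  | zero =>
    exact (injective_iff_map_eq_zero _).1 (Abelian.Ext.precomp_mk₀_injective_of_epi N S.g) ξ (h₂ _)
  | succ i =>
    obtain ⟨y, rfl⟩ := Abelian.Ext.contravariant_sequence_exact₃ hS N ξ (h₂ _) (add_comm 1 i)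
    rw [h₁ i (add_comm 1 i) y, Abelian.Ext.comp_zero]

/-- If `x_j` annihilates `M` and the map `A ⟶ B` is divisible by `x_j`, then the vanishing of
`Ext^i(M, A)` follows from that of `Ext^(i-1)(M, C)`. -/
lemma VarDivisible.ext_eq_zero {S : ShortComplex (GrMod n k)} (hS : S.ShortExact) {j : Fin n}
    (hj : VarDivisible j S.f) {M : GrMod n k} (hM : varMul j M = 0) {i : ℕ}
    (h₃ : ∀ i', i' + 1 = i → ∀ ξ : Abelian.Ext.{u} M S.X₃ i', ξ = 0)
    (ξ : Abelian.Ext.{u} M S.X₁ i) : ξ = 0 := by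
  have := hS.mono_f
  have h := hj.comp_eq_zero hM ξ
  cases i with
  | zero =>
    exact (injective_iff_map_eq_zero _).1 (Abelian.Ext.postcomp_mk₀_injective_of_mono M S.f) ξ h
  | succ i =>
    obtain ⟨y, rfl⟩ := Abelian.Ext.covariant_sequence_exact₁ M hS ξ h rfl
    rw [h₃ i rfl y, Abelian.Ext.zero_comp]

/-- The `i`-th term of the Koszul resolution of `R/(x_j : j ∈ S)` is zero for `i > |S|` and is
generated in the single degree `i`. The induction on `S` adjoins one variable at a time instead of
building the resolution. -/
lemma ext_coneModule_eq_zero (S : Finset (Fin n)) (N : GrMod n k) : ∀ (u : Fin n → ℤ) (s : ℤ)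
    (i : ℕ), (S.card < i ∨ ∀ x : N.obj ⟨∑ j, u j + s + i⟩, x = 0) →
    ∀ ξ : Abelian.Ext.{u} (coneModule k S u s) N i, ξ = 0 := by
  induction S using Finset.induction_on with
  | empty =>
    intro u s i h ξ
    have hB : ∀ c, c ∈ cone ∅ u ↔ u ≤ c := fun c => by simp [cone]
    cases i with
    | zero =>
      obtain ⟨f, rfl⟩ := (Abelian.Ext.mk₀_bijective _ _).2 ξ
      have hN := h.resolve_left (by simp)
      have : f = 0 := by
        refine hom_ext_of_basisElt (mem_cone_self _ _) (fun c => (hB c).1)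
          (d₀ := ⟨∑ j, u j + s + (0 : ℕ)⟩) (by simp) ?_
        rw [hN ((f.app _).hom _), hN (((0 : _ ⟶ N).app _).hom _)]
      rw [this, Abelian.Ext.mk₀_zero]
    | succ i =>
      have := projective_monomialModule (k := k) u hB s
      exact Abelian.Ext.eq_zero_of_projective ξ
  | insert j S hj ih =>
    intro u s i h ξ
    refine ext_eq_zero_of_forall_eq_zero (coneSeq_shortExact hj u s) N (fun i' hi' => ?_)
      (ih u s i ?_) ξ
    · refine ih (u + Pi.single j 1) s i' ?_
      subst hi'
      rw [Finset.card_insert_of_notMem hj] at h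
      refine h.imp (fun h => by omega) fun h => ?_
      have : ∑ i, (u + Pi.single j 1 : Fin n → ℤ) i + s + i' = ∑ j, u j + s + (1 + i' : ℕ) := by
        simp [Finset.sum_add_distrib]
        ring
      rwa [this]
    · rw [Finset.card_insert_of_notMem hj] at h
      exact h.imp (fun h => by omega) id

lemma exists_eq_add_single (v : Fin n → ℤ) (j : Fin n) :
    ∃ w : Fin n → ℤ, v = w + Pi.single j 1 :=
  ⟨v - Pi.single j 1, by simp⟩

lemma sum_add_single (w : Fin n → ℤ) (j : Fin n) :
    ∑ i, (w + Pi.single j 1 : Fin n → ℤ) i = ∑ i, w i + 1 := by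
  simp [Finset.sum_add_distrib]

/-- Rees' grade argument: the `x_j` with `j ∈ S \ T` form a regular sequence on `R/(x_j : j ∈ T)`
and kill `R/(x_j : j ∈ S)`. Each one lowers the cohomological degree by one. -/
lemma ext_coneModule_eq_zero_of_lt_card {S : Finset (Fin n)} (u : Fin n → ℤ) (s t : ℤ) (d : Deg n)
    (i : ℕ) : ∀ (T : Finset (Fin n)) (v : Fin n → ℤ), i < (S \ T).card →
    ∀ ξ : Abelian.Ext.{u} (coneModule k S u s) (shift (coneModule k T v t) d) i, ξ = 0 := by
  induction i with
  | zero =>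
    intro T v hi ξ
    obtain ⟨j, hj⟩ := Finset.card_pos.1 hi
    rw [Finset.mem_sdiff] at hj
    obtain ⟨w, rfl⟩ := exists_eq_add_single v j
    exact ((varDivisible_coneSeq hj.2 w t).shift d).ext_eq_zero
      (shortExact_shift (coneSeq_shortExact hj.2 w t) d) (varMul_coneModule hj.1 u s)
      (fun i' hi' => absurd hi' (by omega)) ξ
  | succ i ih =>
    intro T v hi ξ
    obtain ⟨j, hj⟩ := Finset.card_pos.1 (i.succ_pos.trans hi)
    have hj' := Finset.mem_sdiff.1 hj
    obtain ⟨w, rfl⟩ := exists_eq_add_single v j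
    refine ((varDivisible_coneSeq hj'.2 w t).shift d).ext_eq_zero
      (shortExact_shift (coneSeq_shortExact hj'.2 w t) d) (varMul_coneModule hj'.1 u s)
      (fun i' hi' => ?_) ξ
    obtain rfl : i' = i := by omega
    refine ih (insert j T) w ?_
    rw [Finset.sdiff_insert, Finset.card_erase_of_mem hj]
    omega

/-- Killing the variables of `S \ T` in the second argument reduces to `T` being everything. That
module lives in the single degree `∑ v_j + t`, and the Koszul bound applies. Each step lowers both
the degree of the generator and `i` by one, preserving the inequality. -/
lemma ext_coneModule_eq_zero_of_lt_degree {S : Finset (Fin n)} (u : Fin n → ℤ) (s t : ℤ)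
    (d : Deg n) (m : ℕ) : ∀ (T : Finset (Fin n)) (v : Fin n → ℤ) (i : ℕ), (S \ T).card = m →
    S ∪ T = Finset.univ → ∑ j, v j + t < ∑ j, u j + s + i + d.val →
    ∀ ξ : Abelian.Ext.{u} (coneModule k S u s) (shift (coneModule k T v t) d) i, ξ = 0 := by
  induction m with
  | zero =>
    intro T v i hm hST hlt ξ
    rw [Finset.card_eq_zero, Finset.sdiff_eq_empty_iff_subset] at hm
    rw [Finset.union_eq_right.2 hm] at hST
    subst hST
    refine ext_coneModule_eq_zero _ _ _ _ _ (Or.inr fun x => ?_) ξ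
    refine coeffFun_ext (B := cone Finset.univ v) (s := t) (d := ⟨d.val + (∑ j, u j + s + i)⟩)
      (funext fun c => ?_)
    by_contra h
    obtain ⟨h1, h2⟩ := coeffFun_mem (B := cone Finset.univ v) (s := t)
      (d := ⟨d.val + (∑ j, u j + s + i)⟩) x c h
    rw [mem_cone_univ.1 h1] at h2
    linarith
  | succ m ih =>
    intro T v i hm hST hlt ξ
    obtain ⟨j, hj⟩ := Finset.card_pos.1 (m.succ_pos.trans_eq hm.symm)
    have hj' := Finset.mem_sdiff.1 hj
    obtain ⟨w, rfl⟩ := exists_eq_add_single v j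
    refine ((varDivisible_coneSeq hj'.2 w t).shift d).ext_eq_zero
      (shortExact_shift (coneSeq_shortExact hj'.2 w t) d) (varMul_coneModule hj'.1 u s)
      (fun i' hi' => ?_) ξ
    refine ih (insert j T) w i' ?_ ?_ ?_
    · rw [Finset.sdiff_insert, Finset.card_erase_of_mem hj]
      omega
    · rw [Finset.union_insert, hST, Finset.insert_eq_of_mem (Finset.mem_univ j)]
    · rw [sum_add_single] at hlt
      subst hi'
      push_cast at hlt
      linarith

/-! ### A bound on the regularity in terms of `Ext` from the residue field -/

/-- `Ext^a(k(-e), M) = 0` whenever `a + e > c`. -/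
def ExtVanishAbove (c : ℤ) (M : GrMod n k) : Prop :=
  ∀ (a : ℕ) (b : Fin n → ℤ) (s : ℤ), c < ∑ j, b j + s + a →
    ∀ ξ : Abelian.Ext.{u} (coneModule k Finset.univ b s) M a, ξ = 0

lemma ExtVanishAbove.mono {c c' : ℤ} (hc : c ≤ c') {M : GrMod n k} (h : ExtVanishAbove c M) :
    ExtVanishAbove c' M := fun a b s hlt => h a b s (hc.trans_lt hlt)

lemma ExtVanishAbove.of_iso {c : ℤ} {M N : GrMod n k} (e : M ≅ N) (h : ExtVanishAbove c M) :
    ExtVanishAbove c N := fun a b s hlt ξ => by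
  rw [← comp_mk₀_comp_mk₀_of_id ξ e.inv e.hom e.inv_hom_id,
    h a b s hlt (ξ.comp (Abelian.Ext.mk₀ e.inv) (add_zero a)), Abelian.Ext.zero_comp]

lemma ExtVanishAbove.of_shortExact {c : ℤ} {S : ShortComplex (GrMod n k)} (hS : S.ShortExact)
    (h₁ : ExtVanishAbove c S.X₁) (h₃ : ExtVanishAbove c S.X₃) : ExtVanishAbove c S.X₂ :=
  fun a b s hlt ξ => by
    obtain ⟨y, rfl⟩ := Abelian.Ext.covariant_sequence_exact₂ _ hS ξ (h₃ a b s hlt _)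
    rw [h₁ a b s hlt y, Abelian.Ext.zero_comp]

lemma extVanishAbove_of_forall {c : ℤ} {M : GrMod n k}
    (h : ∀ d : Deg n, c < d.val → ∀ x : M.obj d, x = 0) : ExtVanishAbove c M :=
  fun _ _ _ hlt => ext_coneModule_eq_zero _ _ _ _ _ (Or.inr (h _ hlt))

/-- Induction on the number of variables outside `S ∪ T`. When none is left, the module vanishes in
all degrees above the bound. -/
lemma extVanishAbove_gradedExt_coneModule {S : Finset (Fin n)} (u : Fin n → ℤ) (s t : ℤ) (m : ℕ) :
    ∀ (T : Finset (Fin n)) (v : Fin n → ℤ), Disjoint S T → (S ∪ T)ᶜ.card = m →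
    ExtVanishAbove (∑ j, v j + t - ∑ j, u j - s - S.card)
      (gradedExt S.card (coneModule k S u s) (coneModule k T v t)) := by
  induction m with
  | zero =>
    intro T v hST hm
    rw [Finset.card_eq_zero, Finset.compl_eq_empty_iff] at hm
    exact extVanishAbove_of_forall fun d hd x =>
      ext_coneModule_eq_zero_of_lt_degree u s t d _ T v S.card rfl hm (by linarith) x
  | succ m ih =>
    intro T v hST hm a b s' hlt ξ
    obtain ⟨j, hj⟩ := Finset.card_pos.1 (m.succ_pos.trans_eq hm.symm)
    have hj' := hj
    rw [Finset.mem_compl, Finset.mem_union, not_or] at hj'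
    obtain ⟨w, rfl⟩ := exists_eq_add_single v j
    have hdisj : Disjoint S (insert j T) := Finset.disjoint_insert_right.2 ⟨hj'.1, hST⟩
    -- `Ext^|S|` is exact on the sequence for `x_j`: below `|S|` the grade bound applies, since `S`
    -- is still disjoint from `insert j T`, and above `|S|` the Koszul length bound applies.
    have hE := gradedExtRightSeq_shortExact (coneSeq_shortExact (k := k) hj'.2 w t)
      (coneModule k S u s) S.card
      (fun i d x hi => ext_coneModule_eq_zero_of_lt_card u s t d i (insert j T) w
        (by rw [Finset.sdiff_eq_self_of_disjoint hdisj]; omega) x)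
      (fun d x => ext_coneModule_eq_zero _ _ _ _ _ (Or.inl (Nat.lt_succ_self _)) x)
    refine ((varDivisible_coneSeq hj'.2 w t).gradedExtMapRight S.card
      (coneModule k S u s)).ext_eq_zero hE (varMul_coneModule (Finset.mem_univ j) b s')
      (fun a' ha' => ?_) ξ
    refine ih (insert j T) w hdisj ?_ a' b s' ?_
    · rw [Finset.union_insert, Finset.compl_insert, Finset.card_erase_of_mem hj]
      omega
    · rw [sum_add_single] at hlt
      subst ha'
      push_cast at hlt
      linarith

/-! ### From the residue field to finite monomial modules and local cohomology. -/

lemma ext_middle_eq_zero {S : ShortComplex (GrMod n k)} (hS : S.ShortExact)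
    {N : GrMod n k} {i : ℕ} (h₁ : ∀ ξ : Abelian.Ext.{u} S.X₁ N i, ξ = 0)
    (h₃ : ∀ ξ : Abelian.Ext.{u} S.X₃ N i, ξ = 0) (ξ : Abelian.Ext.{u} S.X₂ N i) : ξ = 0 := by
  obtain ⟨y, rfl⟩ := Abelian.Ext.contravariant_sequence_exact₂ hS N ξ (h₁ _)
  rw [h₃ y, Abelian.Ext.comp_zero]

lemma ext_eq_zero_of_isEmpty {B : Set (Fin n → ℤ)} [B.OrdConnected] (hB : ∀ c, c ∉ B) {s : ℤ}
    {M : GrMod n k} {i : ℕ} (ξ : Abelian.Ext.{u} (monomialModule k B s) M i) : ξ = 0 := by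
  have h0 : 𝟙 (monomialModule k B s) = 0 := by
    ext d x
    refine coeffFun_ext (B := B) (s := s) (d := d) (funext fun c => ?_)
    exact (eq_zero_of_notMem (coeffFun_mem x) (hB c)).trans
      (eq_zero_of_notMem (coeffFun_mem _) (hB c)).symm
  rw [← Abelian.Ext.mk₀_id_comp ξ, h0, Abelian.Ext.mk₀_zero, Abelian.Ext.zero_comp]

lemma ext_eq_zero_of_finite {c : ℤ} {M : GrMod n k} (hM : ExtVanishAbove c M) (s : ℤ) (a : ℕ)
    (m : ℕ) : ∀ (B : Set (Fin n → ℤ)) [B.OrdConnected], B.Finite → B.ncard = m →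
    (∀ b ∈ B, c < ∑ j, b j + s + a) →
    ∀ ξ : Abelian.Ext.{u} (monomialModule k B s) M a, ξ = 0 := by
  induction m with
  | zero =>
    intro B _ hfin hB _ ξ
    rw [Set.ncard_eq_zero hfin] at hB
    exact ext_eq_zero_of_isEmpty (by simp [hB]) ξ
  | succ m ih =>
    intro B hBo hfin hB hlt ξ
    have hne : B.Nonempty := Set.nonempty_of_ncard_ne_zero (by omega)
    -- A minimal monomial splits off as a quotient isomorphic to a shift of `k`; the other monomials
    -- span a submodule.
    obtain ⟨b, hb⟩ := hfin.exists_minimal hne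
    have hup : ∀ c ∈ B \ {b}, ∀ c' ∈ B, c ≤ c' → c' ∈ B \ {b} := fun c hc c' hc' h =>
      ⟨hc', fun h' => hc.2 (le_antisymm (h.trans (le_of_eq h')) (hb.2 hc.1 (h.trans (le_of_eq h'))))⟩
    have hBo' : (B \ {b}).OrdConnected :=
      ⟨fun x hx y hy z hz => hup x hx z (hBo.out hx.1 hy.1 hz) hz.1⟩
    refine ext_middle_eq_zero (splitSeq_shortExact (B \ {b}) B (cone Finset.univ b) s
      (fun c => ?_) (fun c hc c' hc' h => ?_) hup) ?_ ?_ ξ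
    · rw [mem_cone_univ, Set.mem_sdiff, Set.mem_singleton_iff]
      by_cases h : c = b
      · simp [h, hb.1]
      · simp [h]
    · rw [mem_cone_univ] at hc'
      subst hc'
      exact hc.2 (le_antisymm h (hb.2 hc.1 h))
    · refine ih (B \ {b}) (hfin.sdiff) ?_ (fun c hc => hlt c hc.1)
      rw [Set.ncard_sdiff_singleton_of_mem hb.1, hB]
      rfl
    · exact hM a b s (hlt b hb.1)

/-- The nonnegative exponent vectors of total degree less than `t`. -/
def truncation (n t : ℕ) : Set (Fin n → ℤ) := {c | 0 ≤ c ∧ ∑ j, c j < t}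

lemma finite_truncation (n t : ℕ) : (truncation n t).Finite := by
  refine (Set.finite_Icc (0 : Fin n → ℤ) (fun _ => (t : ℤ))).subset fun c hc => ⟨hc.1, fun j => ?_⟩
  exact (Finset.single_le_sum (fun i _ => hc.1 i) (Finset.mem_univ j)).trans hc.2.le

instance (n t : ℕ) : (truncation n t).OrdConnected where
  out' _ hx _ hy _ hz := ⟨hx.1.trans hz.1, (Finset.sum_le_sum fun j _ => hz.2 j).trans_lt hy.2⟩

lemma expVec_mem_truncation {t : ℕ} {a : Fin n →₀ ℕ} :
    0 + expVec a ∈ truncation n t ↔ a.degree < t := by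
  rw [zero_add]
  refine ⟨fun h => ?_, fun h => ⟨expVec_nonneg a, ?_⟩⟩
  · have := h.2
    rw [sum_expVec] at this
    exact_mod_cast this
  · rw [sum_expVec]
    exact_mod_cast h

/-- A cocycle which is `𝔪`-torsion is the coboundary of an `𝔪`-torsion element, in an injective
resolution of `M`, in the range where the `Ext` from the residue field vanishes. -/
lemma exists_torsion_coboundary {c : ℤ} {M : GrMod n k} (hM : ExtVanishAbove c M)
    (P : InjectiveResolution M) (i : ℕ) (d : Deg n) (hd : c < d.val + i)
    (z : (P.cocomplex.X i).obj d) (hz : z ∈ torsionPart (P.cocomplex.X i) d)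
    (hz' : ((P.cocomplex.d i (i + 1)).app d).hom z = 0) :
    (i = 0 ∧ z = 0) ∨ ∃ p, p + 1 = i ∧ ∃ w ∈ torsionPart (P.cocomplex.X p) d,
      ((P.cocomplex.d p i).app d).hom w = z := by
  obtain ⟨t, ht⟩ := hz
  -- The exponent `t + 1` instead of `t` ensures that the monomial `1` survives in the truncation
  -- when `t = 0`.
  let B := truncation n (t + 1)
  have h0 : (0 : Fin n → ℤ) ∈ B := ⟨le_rfl, by simp⟩
  have hB0 : ∀ c ∈ B, 0 ≤ c := fun c hc => hc.1
  have hd₀ : ∑ j, (0 : Fin n → ℤ) j + d.val = d.val := by simp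
  have hz1 : ∀ (e : Deg n) (f : d ⟶ e), 0 + expVec f.exp ∉ B →
      ((P.cocomplex.X i).map f).hom z = 0 := fun e f hf => ht e f (by
    have := mt expVec_mem_truncation.2 hf
    omega)
  let φ : monomialModule k B d.val ⟶ P.cocomplex.X i := monomialDesc hB0 z hz1
  have hφ : (φ.app d).hom (basisElt k h0 hd₀) = z := monomialDesc_basisElt h0 hB0 hd₀ z hz1
  have hφd : φ ≫ P.cocomplex.d i (i + 1) = 0 := by
    refine hom_ext_of_basisElt h0 hB0 hd₀ ?_
    exact (congrArg ((P.cocomplex.d i (i + 1)).app d).hom hφ).trans hz'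
  -- The truncated ring is generated in degree `d`, so all its composition factors `k(-e)` have `e ≥
  -- d`, hence `e + i > c`.
  have hExt : ∀ ξ : Abelian.Ext.{u} (monomialModule k B d.val) M i, ξ = 0 :=
    ext_eq_zero_of_finite hM d.val i _ B (finite_truncation n _) rfl fun b hb => by
      have : 0 ≤ ∑ j, b j := Finset.sum_nonneg fun j _ => hb.1 j
      linarith
  cases i with
  | zero =>
    left
    refine ⟨rfl, ?_⟩
    let g := P.isLimitKernelFork.lift (KernelFork.ofι φ hφd)
    have hg : g ≫ P.ι.f 0 = φ := P.isLimitKernelFork.fac (KernelFork.ofι φ hφd) .zero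
    have hg0 : g = 0 := (Abelian.Ext.mk₀_eq_zero_iff _).1 (hExt _)
    have hφ0 : φ = 0 := by
      rw [← hg, hg0]
      exact zero_comp
    rw [← hφ, hφ0]
    rfl
  | succ p =>
    right
    refine ⟨p, rfl, ?_⟩
    -- The cocycle `φ` represents a zero class, so it factors as `g` followed by the differential.
    -- The image of the generator under `g` is torsion, as the generator itself is.
    obtain ⟨g, hg⟩ := (P.extMk_eq_zero_iff φ (p + 1 + 1) rfl hφd p rfl).1 (hExt _)
    refine ⟨(g.app d).hom (basisElt k h0 hd₀), ⟨t + 1, fun e f hf => ?_⟩, ?_⟩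
    · rw [← naturality_apply, map_basisElt_eq_zero h0 hd₀ f, map_zero]
      rw [expVec_mem_truncation]
      omega
    · rw [← hφ, ← hg]
      rfl

lemma localCohomology_eq_zero {c : ℤ} {M : GrMod n k} (hM : ExtVanishAbove c M) (i : ℕ) (d : Deg n)
    (hd : c < d.val + i) : Subsingleton ((localCohomology i M).obj d) := by
  let P := injectiveResolution M
  let K := ((torsion n k).mapHomologicalComplex (ComplexShape.up ℕ)).obj P.cocomplex
  let F := (evaluation (Deg n) (ModuleCat.{u} k)).obj d
  have e : (localCohomology i M).obj d ≅ ((K.sc i).map F).homology :=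
    F.mapIso (P.isoRightDerivedObj (torsion n k) i) ≪≫ ((K.sc i).mapHomologyIso F).symm
  refine ModuleCat.subsingleton_of_isZero (IsZero.of_iso ?_ e)
  rw [← ShortComplex.exact_iff_isZero_homology, ShortComplex.moduleCat_exact_iff]
  intro z hz
  -- The homology of the complex is stated with `next i` and `prev i`, which equal `i + 1` and `i -
  -- 1` only propositionally; hence the generalization to `q`.
  have hz' : ∀ q, q = i + 1 → ((P.cocomplex.d i q).app d).hom z.1 = 0 →
      ((P.cocomplex.d i (i + 1)).app d).hom z.1 = 0 := by
    rintro q rfl h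
    exact h
  rcases exists_torsion_coboundary hM P i d hd z.1 z.2
    (hz' ((ComplexShape.up ℕ).next i) (by simp) (congrArg Subtype.val hz)) with h | ⟨p, rfl, w, hw, h⟩
  · refine ⟨0, ?_⟩
    rw [map_zero]
    exact Subtype.ext h.2.symm
  · have key : ∀ q, q = p → ∃ w ∈ torsionPart (P.cocomplex.X q) d,
        ((P.cocomplex.d q (p + 1)).app d).hom w = z.1 := by
      rintro q rfl
      exact ⟨w, hw, h⟩
    obtain ⟨w', hw', h'⟩ := key ((ComplexShape.up ℕ).prev (p + 1)) (by simp)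
    exact ⟨⟨w', hw'⟩, Subtype.ext h'⟩

lemma reg_le {c : ℤ} {M : GrMod n k} (hM : ExtVanishAbove c M) : reg M ≤ ((c : ℝ) : EReal) := by
  refine iSup_le fun i => ?_
  have h : degSup (localCohomology i M) ≤ (((c - i : ℤ) : ℝ) : EReal) := by
    refine iSup_le fun d => iSup_le fun hd => ?_
    rw [EReal.coe_le_coe_iff, Int.cast_le]
    by_contra hlt
    exact (not_nontrivial_iff_subsingleton.2 (localCohomology_eq_zero hM i d (by omega))) hd
  refine (add_le_add_left h _).trans (le_of_eq ?_)
  rw [← EReal.coe_add, Int.cast_sub, Int.cast_natCast, sub_add_cancel]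

/-! ### The filtration of the quotient by a weakly stable ideal -/

/-- The exponent vectors which do not belong to `A`. -/
def stdSet (A : Set (Fin n →₀ ℕ)) : Set (Fin n → ℤ) := {c | ∃ a, expVec a = c ∧ a ∉ A}

lemma expVec_le_expVec {a b : Fin n →₀ ℕ} : expVec a ≤ expVec b ↔ a ≤ b :=
  ⟨fun h j => Int.ofNat_le.1 (h j), fun h j => Int.ofNat_le.2 (h j)⟩

lemma expVec_mem_stdSet {A : Set (Fin n →₀ ℕ)} {a : Fin n →₀ ℕ} :
    expVec a ∈ stdSet A ↔ a ∉ A :=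
  ⟨fun ⟨_, hb, hA⟩ => expVec_injective hb ▸ hA, fun h => ⟨a, rfl, h⟩⟩

lemma nonneg_of_mem_stdSet {A : Set (Fin n →₀ ℕ)} {c : Fin n → ℤ} (hc : c ∈ stdSet A) : 0 ≤ c := by
  obtain ⟨a, rfl, -⟩ := hc
  exact expVec_nonneg a

lemma mem_stdSet_of_le {A : Set (Fin n →₀ ℕ)} (hA : IsUpperSet A) {c c' : Fin n → ℤ}
    (hc : c ∈ stdSet A) (h0 : 0 ≤ c') (h : c' ≤ c) : c' ∈ stdSet A := by
  obtain ⟨a, rfl, ha⟩ := hc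
  obtain ⟨b, rfl⟩ := exists_expVec_eq h0
  exact expVec_mem_stdSet.2 fun hb => ha (hA (expVec_le_expVec.1 h) hb)

lemma ordConnected_stdSet {A : Set (Fin n →₀ ℕ)} (hA : IsUpperSet A) : (stdSet A).OrdConnected :=
  ⟨fun _ hx _ hy _ hz => mem_stdSet_of_le hA hy ((nonneg_of_mem_stdSet hx).trans hz.1) hz.2⟩

/-- The combinatorial form of weak stability, for a set of exponent vectors. -/
def WeaklyStableSet (A : Set (Fin n →₀ ℕ)) : Prop :=
  ∀ a ∈ A, ∀ m : Fin n, IsGreatest {i : Fin n | a i ≠ 0} m → ∀ j < m, ∃ c : ℕ,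
    Finsupp.single j c + (a - Finsupp.single m (a m)) ∈ A

/-- The bounds on `Ext(M, R)` which propagate along the filtration. -/
structure ExtBounds (m : ℕ) (M : GrMod n k) : Prop where
  vanish_above (i : ℕ) : ExtVanishAbove (-i) (gradedExt i M (coneModule k ∅ 0 0))
  eq_zero (i : ℕ) (d : Deg n) (hi : m < i) :
    ∀ ξ : Abelian.Ext.{u} M (shift (coneModule k ∅ 0 0) d) i, ξ = 0

/-! ### Propagation of the `Ext` bounds along one step of the filtration. -/

lemma extVanishAbove_coneModule (S : Finset (Fin n)) {u : Fin n → ℤ} (hu : 0 ≤ u) (i : ℕ) :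
    ExtVanishAbove (-i) (gradedExt i (coneModule k S u 0) (coneModule k ∅ 0 0)) := by
  rcases lt_trichotomy i S.card with h | rfl | h
  · exact extVanishAbove_of_forall fun d _ x =>
      ext_coneModule_eq_zero_of_lt_card u 0 0 d i ∅ 0 (by simpa using h) x
  · refine (extVanishAbove_gradedExt_coneModule u 0 0 _ ∅ 0 (Finset.disjoint_empty_right S)
      rfl).mono ?_
    have : 0 ≤ ∑ j, u j := Finset.sum_nonneg fun j _ => hu j
    simp only [Pi.zero_apply, Finset.sum_const_zero]
    linarith
  · exact extVanishAbove_of_forall fun d _ x =>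
      ext_coneModule_eq_zero S _ u 0 i (Or.inl h) x

lemma ExtBounds.of_shortExact {S : ShortComplex (GrMod n k)} (hS : S.ShortExact)
    {s : Finset (Fin n)} {u : Fin n → ℤ} (hu : 0 ≤ u) (e : S.X₁ = coneModule k s u 0)
    (h : ExtBounds s.card S.X₃) : ExtBounds s.card S.X₂ := by
  have h₁ : ∀ (i : ℕ) (d : Deg n), i ≠ s.card →
      ∀ ξ : Abelian.Ext.{u} S.X₁ (shift (coneModule k ∅ 0 0) d) i, ξ = 0 := by
    rw [e]
    intro i d hi ξ
    rcases lt_or_gt_of_ne hi with hi | hi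
    · exact ext_coneModule_eq_zero_of_lt_card u 0 0 d i ∅ 0 (by simpa using hi) ξ
    · exact ext_coneModule_eq_zero s _ u 0 i (Or.inl hi) ξ
  refine ⟨fun i => ?_, fun i d hi => ext_middle_eq_zero hS (h₁ i d hi.ne') (h.eq_zero i d hi)⟩
  -- The submodule has `Ext` only in degree `s.card`, and the connecting map from there lands in
  -- degree `s.card + 1`, where the quotient has none.
  have hE := gradedExtLeftSeq_shortExact hS (coneModule k ∅ 0 0) i fun j d x j' hj => by
    by_cases hjs : j = s.card
    · exact h.eq_zero j' d (by omega) _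
    · rw [h₁ j d hjs x, Abelian.Ext.comp_zero]
  refine ExtVanishAbove.of_shortExact hE (h.vanish_above i) ?_
  change ExtVanishAbove _ (gradedExt i S.X₁ _)
  rw [e]
  exact extVanishAbove_coneModule s hu i

lemma ExtBounds.of_isEmpty {B : Set (Fin n → ℤ)} [B.OrdConnected] (hB : ∀ c, c ∉ B) (m : ℕ) :
    ExtBounds m (monomialModule k B 0) :=
  ⟨fun _ => extVanishAbove_of_forall fun _ _ (ξ : Abelian.Ext.{u} _ _ _) =>
    ext_eq_zero_of_isEmpty hB ξ, fun _ _ _ ξ => ext_eq_zero_of_isEmpty hB ξ⟩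

/-! ### Corners of weakly stable sets. -/

/-- The indices smaller than `m`. -/
def initialVars (n m : ℕ) : Finset (Fin n) := Finset.univ.filter fun j => j.val < m

lemma mem_initialVars {m : ℕ} {j : Fin n} : j ∈ initialVars n m ↔ j.val < m := by
  simp [initialVars]

lemma card_initialVars {m : ℕ} (h : m ≤ n) : (initialVars n m).card = m := by
  simp [initialVars, Fin.card_filter_val_lt, h]

/-- The part of an exponent vector involving only the first `m` variables. -/
def initialPart (m : ℕ) (a : Fin n →₀ ℕ) : Fin n →₀ ℕ := a.filter fun j => j.val < m

lemma initialPart_of_lt {m : ℕ} {a : Fin n →₀ ℕ} {j : Fin n} (hj : j.val < m) :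
    initialPart m a j = a j := Finsupp.filter_apply_pos (fun j : Fin n => j.val < m) a hj

lemma initialPart_of_le {m : ℕ} {a : Fin n →₀ ℕ} {j : Fin n} (hj : m ≤ j.val) :
    initialPart m a j = 0 := Finsupp.filter_apply_neg (fun j : Fin n => j.val < m) a hj.not_gt

/-- A monomial outside a weakly stable ideal with colon ideal `(x_0, …, x_(m-1))`. -/
structure IsCorner (A : Set (Fin n →₀ ℕ)) (m : ℕ) (u : Fin n →₀ ℕ) : Prop where
  notMem : u ∉ A
  eq_zero (j : Fin n) (hj : m ≤ j.val) : u j = 0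
  mem (j : Fin n) (hj : j.val < m) : u + Finsupp.single j 1 ∈ A

lemma IsCorner.mem_of_lt {A : Set (Fin n →₀ ℕ)} (hA : IsUpperSet A) {m : ℕ} {u a : Fin n →₀ ℕ}
    (hu : IsCorner A m u) (hua : u ≤ a) {j : Fin n} (hj : j.val < m) (hj' : a j ≠ u j) : a ∈ A := by
  refine hA (fun i => ?_) (hu.mem j hj)
  by_cases h : i = j
  · subst h
    have := hua i
    simp only [Finsupp.add_apply, Finsupp.single_eq_same]
    omega
  · simpa [Finsupp.single_apply, Ne.symm h] using hua i

/-- Only multiples of `u` outside `A` need checking. If the last variable is one of the first `m`,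
such a multiple is `u` itself, and the condition is inherited from `u + e_p ∈ A`, which loses the
same power of `x_p`. Otherwise `x_p` does not divide `u`, and removing it leaves a multiple of `u`.
-/
lemma IsCorner.weaklyStableSet {A : Set (Fin n →₀ ℕ)} (hA : IsUpperSet A)
    (hw : WeaklyStableSet A) {m : ℕ} {u : Fin n →₀ ℕ} (hu : IsCorner A m u) :
    WeaklyStableSet (A ∪ Set.Ici u) := by
  intro a ha p hp j hj
  by_cases haA : a ∈ A
  · obtain ⟨c, hc⟩ := hw a haA p hp j hj
    exact ⟨c, Or.inl hc⟩
  have hua : u ≤ a := ha.resolve_left haA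
  by_cases hpm : p.val < m
  · have hau : a = u := by
      ext i
      by_contra hi
      refine haA (hu.mem_of_lt hA hua (lt_of_le_of_lt ?_ hpm) hi)
      have := hua i
      exact hp.2 (show a i ≠ 0 by omega)
    subst hau
    have hp' : IsGreatest {i : Fin n | (a + Finsupp.single p 1 : Fin n →₀ ℕ) i ≠ 0} p := by
      refine ⟨by simp, fun i hi => ?_⟩
      by_cases h : i = p
      · exact h.le
      · exact hp.2 (by simpa [Ne.symm h] using hi)
    obtain ⟨c, hc⟩ := hw _ (hu.mem p hpm) p hp' j hj
    refine ⟨c, Or.inl ?_⟩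
    convert hc using 2
    ext i
    by_cases h : i = p
    · subst h; simp
    · simp [Ne.symm h]
  · refine ⟨0, Or.inr fun i => ?_⟩
    have h0 := hu.eq_zero p (not_lt.1 hpm)
    by_cases h : i = p
    · subst h
      rw [h0]
      exact Nat.zero_le _
    · simpa [Finsupp.single_apply, Ne.symm h] using hua i

/-- The monomial `initialPart m a` is outside `A`, but a power of each of `x_0, …, x_m` multiplies
it into `A`: for `x_m` because `initialPart (m + 1) a ∈ A`, for the others by weak stability. So it
has only finitely many multiples in these variables outside `A`, and a maximal one is a corner. -/
lemma exists_isCorner {A : Set (Fin n →₀ ℕ)} (hA : IsUpperSet A) (hw : WeaklyStableSet A) {m : ℕ}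
    (hm : m < n) (hcl : ∀ a ∈ A, initialPart (m + 1) a ∈ A)
    {a : Fin n →₀ ℕ} (ha : a ∈ A) (ha' : initialPart m a ∉ A) :
    ∃ u, IsCorner A (m + 1) u := by
  let p : Fin n := ⟨m, hm⟩
  let u₀ := initialPart m a
  let a₁ := initialPart (m + 1) a
  have h₁ : a₁ = Finsupp.single p (a p) + u₀ := by
    ext i
    by_cases h : i = p
    · subst h
      simp [a₁, u₀, p, initialPart_of_lt, initialPart_of_le]
    · have h' : i.val ≠ m := fun h' => h (Fin.ext h')
      rw [Finsupp.add_apply, Finsupp.single_eq_of_ne h, zero_add]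
      by_cases hi : i.val < m
      · exact (initialPart_of_lt (by omega)).trans (initialPart_of_lt hi).symm
      · exact (initialPart_of_le (by omega)).trans (initialPart_of_le (not_lt.1 hi)).symm
  have hap : a p ≠ 0 := fun h0 => ha' (by
    have := hcl a ha
    change a₁ ∈ A at this
    rwa [h₁, h0, Finsupp.single_zero, zero_add] at this)
  have hp : IsGreatest {i | a₁ i ≠ 0} p := by
    refine ⟨by simpa [a₁, p, initialPart_of_lt] using hap, fun i hi => ?_⟩
    have : i.val < m + 1 := by
      by_contra h
      exact hi (initialPart_of_le (not_lt.1 h))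
    exact Nat.lt_succ_iff.1 this
  have hb : ∀ j : Fin n, ∃ c : ℕ, j.val < m + 1 → Finsupp.single j c + u₀ ∈ A := by
    intro j
    by_cases hj : j.val < m
    · obtain ⟨c, hc⟩ := hw a₁ (hcl a ha) p hp j hj
      refine ⟨c, fun _ => ?_⟩
      convert hc using 2
      ext i
      by_cases h : i = p
      · subst h; simp [h₁, u₀, p, initialPart_of_le]
      · simp [h₁, Ne.symm h]
    · refine ⟨a p, fun hj' => ?_⟩
      obtain rfl : j = p := Fin.ext (by change j.val = m; omega)
      rw [← h₁]
      exact hcl a ha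
  choose b hb using hb
  let T : Set (Fin n →₀ ℕ) := {v | u₀ ≤ v ∧ v ∉ A ∧ ∀ j : Fin n, m + 1 ≤ j.val → v j = 0}
  have hT : T.Finite := by
    refine (Set.finite_Iic (Finsupp.equivFunOnFinite.symm fun j => u₀ j + b j)).subset ?_
    rintro v ⟨hv, hvA, hv0⟩ j
    change v j ≤ u₀ j + b j
    by_cases hj : j.val < m + 1
    · by_contra hlt
      refine hvA (hA (fun i => ?_) (hb j hj))
      by_cases h : i = j
      · subst h
        simp only [Finsupp.add_apply, Finsupp.single_eq_same]
        omega
      · simpa [Finsupp.single_apply, Ne.symm h] using hv i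
    · rw [hv0 j (not_lt.1 hj)]
      exact Nat.zero_le _
  have hu₀ : u₀ ∈ T := ⟨le_rfl, ha', fun j hj => initialPart_of_le (by omega)⟩
  obtain ⟨u, hu⟩ := hT.exists_maximal ⟨u₀, hu₀⟩
  refine ⟨u, hu.1.2.1, hu.1.2.2, fun j hj => ?_⟩
  by_contra hA'
  have hle : u ≤ u + Finsupp.single j 1 := le_self_add
  have := hu.2 ⟨hu.1.1.trans hle, hA', fun i hi => ?_⟩ hle j
  · simp at this
  · have : j ≠ i := fun h => by subst h; omega
    simp [hu.1.2.2 i hi, this]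

/-! ### Induction over the filtration. -/

/-- The monomial ideal with a given set of exponent vectors. -/
def idealOfSet (k : Type u) [Field k] (A : Set (Fin n →₀ ℕ)) : Ideal (MvPolynomial (Fin n) k) :=
  Ideal.span ((fun a => MvPolynomial.monomial a (1 : k)) '' A)

lemma monomial_mem_idealOfSet {A : Set (Fin n →₀ ℕ)} {a : Fin n →₀ ℕ} :
    MvPolynomial.monomial a (1 : k) ∈ idealOfSet k A ↔ ∃ b ∈ A, b ≤ a := by
  rw [idealOfSet, MvPolynomial.mem_ideal_span_monomial_image]
  classical
  simp [MvPolynomial.support_monomial]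

lemma idealOfSet_lt {A : Set (Fin n →₀ ℕ)} (hA : IsUpperSet A) {u : Fin n →₀ ℕ} (hu : u ∉ A) :
    idealOfSet k A < idealOfSet k (A ∪ Set.Ici u) := by
  refine lt_of_le_of_ne (Ideal.span_mono (Set.image_mono Set.subset_union_left)) fun h => ?_
  have h1 : MvPolynomial.monomial u (1 : k) ∈ idealOfSet k (A ∪ Set.Ici u) :=
    monomial_mem_idealOfSet.2 ⟨u, Or.inr Set.self_mem_Ici, le_rfl⟩
  rw [← h, monomial_mem_idealOfSet] at h1
  obtain ⟨b, hb, hbu⟩ := h1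
  exact hu (hA hbu hb)

lemma IsCorner.extBounds {A : Set (Fin n →₀ ℕ)} (hA : IsUpperSet A) {m : ℕ} (hm : m ≤ n)
    (hcl : ∀ a ∈ A, initialPart m a ∈ A)
    {u : Fin n →₀ ℕ} (hu : IsCorner A m u) [(stdSet A).OrdConnected]
    [(stdSet (A ∪ Set.Ici u)).OrdConnected]
    (h : ExtBounds m (monomialModule k (stdSet (A ∪ Set.Ici u)) 0)) :
    ExtBounds m (monomialModule k (stdSet A) 0) := by
  let S := initialVars n m
  have hS : S.card = m := card_initialVars hm
  -- The submodule generated by `x^u` is exactly a cone: changing one of the first `m` exponents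
  -- enters `A`, while an `a ∈ A` differing from `u` only in later variables would give `u =
  -- initialPart m a ∈ A`.
  have hcone : ∀ a : Fin n →₀ ℕ, expVec a ∈ cone S (expVec u) ↔ u ≤ a ∧ a ∉ A := by
    intro a
    constructor
    · rintro ⟨h1, h2⟩
      have hua := expVec_le_expVec.1 h1
      refine ⟨hua, fun ha => hu.notMem ?_⟩
      convert hcl a ha using 1
      ext j
      by_cases hj : j.val < m
      · rw [initialPart_of_lt hj]
        exact Int.ofNat_injective (h2 j (mem_initialVars.2 hj)).symm
      · rw [initialPart_of_le (not_lt.1 hj), hu.eq_zero j (not_lt.1 hj)]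
    · rintro ⟨h1, h2⟩
      refine ⟨expVec_le_expVec.2 h1, fun j hj => congrArg Nat.cast (?_ : a j = u j)⟩
      by_contra h3
      exact h2 (hu.mem_of_lt hA h1 (mem_initialVars.1 hj) h3)
  have hexp : ∀ c ∈ cone S (expVec u), ∃ a, expVec a = c := fun c hc =>
    exists_expVec_eq ((expVec_nonneg u).trans hc.1)
  have hle : ∀ c ∈ stdSet A, expVec u ≤ c → c ∈ cone S (expVec u) := by
    rintro _ ⟨a, rfl, ha⟩ h
    exact (hcone a).2 ⟨expVec_le_expVec.1 h, ha⟩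
  have hseq := splitSeq_shortExact (k := k) (cone S (expVec u)) (stdSet A)
    (stdSet (A ∪ Set.Ici u)) 0 (fun c => ?_) (fun c hc c' hc' h => ?_)
    (fun c hc c' hc' h => hle c' hc' (hc.1.trans h))
  · rw [← hS] at h ⊢
    exact ExtBounds.of_shortExact hseq (expVec_nonneg u) rfl h
  · constructor
    · rintro ⟨a, rfl, ha⟩
      by_cases hua : u ≤ a
      · exact Or.inl ((hcone a).2 ⟨hua, ha⟩)
      · exact Or.inr (expVec_mem_stdSet.2 (not_or.2 ⟨ha, hua⟩))
    · rintro (hc | ⟨a, rfl, ha⟩)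
      · obtain ⟨a, rfl⟩ := hexp c hc
        exact expVec_mem_stdSet.2 ((hcone a).1 hc).2
      · exact expVec_mem_stdSet.2 fun h => ha (Or.inl h)
  · obtain ⟨a', rfl, ha'⟩ := hc'
    exact ha' (Or.inr (expVec_le_expVec.1 (hc.1.trans h)))

/-- The last hypothesis says that the ideal is generated by monomials in the first `m` variables.
Corners are added, by Noetherian induction on the ideal, until the first `m - 1` variables suffice;
then `m` drops. For `m = 0` the ideal is `0` or `R`. -/
lemma extBounds_stdSet (m : ℕ) (hm : m ≤ n) : ∀ (A : Set (Fin n →₀ ℕ)) [(stdSet A).OrdConnected],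
    IsUpperSet A → WeaklyStableSet A → (∀ a ∈ A, initialPart m a ∈ A) →
    ExtBounds m (monomialModule k (stdSet A) 0) := by
  induction m with
  | zero =>
    intro A _ hA hw hcl
    by_cases h0 : (0 : Fin n →₀ ℕ) ∈ A
    · exact ExtBounds.of_isEmpty (by rintro _ ⟨a, rfl, ha⟩; exact ha (hA zero_le h0)) _
    · have hu : IsCorner A 0 0 := ⟨h0, fun _ _ => rfl, fun j hj => absurd hj (by omega)⟩
      have : (stdSet (A ∪ Set.Ici 0)).OrdConnected :=
        ordConnected_stdSet (hA.union (isUpperSet_Ici _))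
      exact hu.extBounds hA hm hcl
        (ExtBounds.of_isEmpty (by rintro _ ⟨a, rfl, ha⟩; exact ha (Or.inr (Set.mem_Ici.2 zero_le))) _)
  | succ m ihm =>
    intro A
    induction hI : idealOfSet k A using WellFoundedGT.induction generalizing A with
    | ind I ih =>
      intro _ hA hw hcl
      by_cases hm' : ∀ a ∈ A, initialPart m a ∈ A
      · have h := ihm (by omega) A hA hw hm'
        exact ⟨h.vanish_above, fun i d hi => h.eq_zero i d (by omega)⟩
      · push Not at hm'
        obtain ⟨a, ha, ha'⟩ := hm'
        obtain ⟨u, hu⟩ := exists_isCorner hA hw hm hcl ha ha'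
        have hA' := hA.union (isUpperSet_Ici u)
        have := ordConnected_stdSet hA'
        refine hu.extBounds hA hm hcl (ih _ (hI ▸ idealOfSet_lt hA hu.notMem) _ rfl hA'
          (hu.weaklyStableSet hA hw) ?_)
        rintro b (hb | hb)
        · exact Or.inl (hcl b hb)
        · refine Or.inr fun j => ?_
          by_cases hj : j.val < m + 1
          · rw [initialPart_of_lt hj]
            exact hb j
          · rw [hu.eq_zero j (not_lt.1 hj)]
            exact Nat.zero_le _

/-! ### Comparison of `R/I` with a module with monomial basis -/

/-- The exponent vector with natural number entries attached to a nonnegative integer vector. -/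
def natVec (c : Fin n → ℤ) : Fin n →₀ ℕ := Finsupp.equivFunOnFinite.symm fun j => (c j).toNat

lemma natVec_expVec (a : Fin n →₀ ℕ) : natVec (expVec a) = a := by
  ext j; simp [natVec, expVec]

open Classical in
/-- The function of coefficients of a polynomial, restricted to `B`. -/
def polyCoeff (k : Type u) [Field k] (B : Set (Fin n → ℤ)) :
    MvPolynomial (Fin n) k →ₗ[k] ((Fin n → ℤ) → k) where
  toFun p c := if c ∈ B then p.coeff (natVec c) else 0
  map_add' p q := by ext c; by_cases h : c ∈ B <;> simp [h]
  map_smul' r p := by ext c; by_cases h : c ∈ B <;> simp [h]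

lemma polyCoeff_expVec {A : Set (Fin n →₀ ℕ)} {a : Fin n →₀ ℕ} (ha : a ∉ A)
    (p : MvPolynomial (Fin n) k) : polyCoeff k (stdSet A) p (expVec a) = p.coeff a :=
  (if_pos (expVec_mem_stdSet.2 ha)).trans (by rw [natVec_expVec])

lemma polyCoeff_of_notMem {B : Set (Fin n → ℤ)} {c : Fin n → ℤ} (hc : c ∉ B)
    (p : MvPolynomial (Fin n) k) : polyCoeff k B p c = 0 := if_neg hc

lemma polyCoeff_mem {A : Set (Fin n →₀ ℕ)} {d : ℤ} {p : MvPolynomial (Fin n) k}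
    (hp : p ∈ polyPart n k d) : polyCoeff k (stdSet A) p ∈ monomialPart k (stdSet A) 0 d := by
  intro c hc
  by_cases h : c ∈ stdSet A
  · refine ⟨h, ?_⟩
    obtain ⟨a, rfl, ha⟩ := h
    rw [polyCoeff_expVec ha] at hc
    rw [sum_expVec, add_zero]
    exact hp a hc
  · exact absurd (polyCoeff_of_notMem h p) hc

lemma polyCoeff_monomial_mul {A : Set (Fin n →₀ ℕ)} (hA : IsUpperSet A) (b : Fin n →₀ ℕ)
    (p : MvPolynomial (Fin n) k) : polyCoeff k (stdSet A) (MvPolynomial.monomial b (1 : k) * p) =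
      translate k (stdSet A) (expVec b) (polyCoeff k (stdSet A) p) := by
  ext c
  by_cases hc : c ∈ stdSet A
  · rw [translate_of_mem hc]
    obtain ⟨a, rfl, ha⟩ := hc
    rw [polyCoeff_expVec ha, MvPolynomial.coeff_monomial_mul']
    split_ifs with hba
    · have h : expVec a - expVec b = expVec (a - b) := by
        rw [sub_eq_iff_eq_add, ← expVec_add, tsub_add_cancel_of_le hba]
      rw [h, polyCoeff_expVec fun h' => ha (hA tsub_le_self h'), one_mul]
    · refine (polyCoeff_of_notMem (fun h => hba ?_) p).symm
      have := nonneg_of_mem_stdSet h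
      exact expVec_le_expVec.1 (sub_nonneg.1 this)
  · rw [translate_of_notMem hc, polyCoeff_of_notMem hc]

lemma exists_polyCoeff_eq {A : Set (Fin n →₀ ℕ)} {d : ℤ} {φ : (Fin n → ℤ) → k}
    (hφ : φ ∈ monomialPart k (stdSet A) 0 d) :
    ∃ p ∈ polyPart n k d, polyCoeff k (stdSet A) p = φ := by
  classical
  -- `φ` is supported in degree `d`, so this finite set contains every exponent with a nonzero
  -- coefficient.
  have hfin := Finsupp.finite_of_degree_le (σ := Fin n) d.toNat
  let p : MvPolynomial (Fin n) k := ∑ a ∈ hfin.toFinset, MvPolynomial.monomial a (φ (expVec a))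
  have hp : ∀ a, p.coeff a = φ (expVec a) := by
    intro a
    rw [MvPolynomial.coeff_sum]
    simp only [MvPolynomial.coeff_monomial]
    rw [Finset.sum_ite_eq']
    refine (ite_eq_left_iff.2 fun h => ?_)
    by_contra h'
    have h1 := (hφ _ (Ne.symm h')).2
    rw [sum_expVec] at h1
    refine h (hfin.mem_toFinset.2 ?_)
    change a.degree ≤ d.toNat
    omega
  refine ⟨p, fun a ha => ?_, ?_⟩
  · rw [hp] at ha
    have := (hφ _ ha).2
    rwa [sum_expVec, add_zero] at this
  · ext c
    by_cases hc : c ∈ stdSet A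
    · obtain ⟨a, rfl, ha⟩ := hc
      rw [polyCoeff_expVec ha, hp]
    · rw [polyCoeff_of_notMem hc, eq_zero_of_notMem hφ hc]

lemma stdSet_empty : stdSet (∅ : Set (Fin n →₀ ℕ)) = cone ∅ 0 := by
  ext c
  refine ⟨fun h => ⟨nonneg_of_mem_stdSet h, fun j hj => absurd hj (Finset.notMem_empty j)⟩,
    fun h => ?_⟩
  obtain ⟨a, rfl⟩ := exists_expVec_eq h.1
  exact expVec_mem_stdSet.2 (Set.notMem_empty a)

/-- The polynomial ring has the monomials with nonnegative exponents as a basis. -/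
def polyRingIso (n : ℕ) (k : Type u) [Field k] : polyRing n k ≅ coneModule k ∅ 0 0 :=
  let φ : polyRing n k ⟶ coneModule k ∅ 0 0 :=
    { app := fun d => ModuleCat.ofHom ((polyCoeff k (cone ∅ 0)).restrict
        (p := polyPart n k d.val) (q := monomialPart k (cone ∅ 0) 0 d.val)
        (fun p hp => stdSet_empty (n := n) ▸ polyCoeff_mem hp))
      naturality := fun d e f => ModuleCat.hom_ext (LinearMap.ext fun p => Subtype.ext (by
        have h := polyCoeff_monomial_mul (A := ∅) isUpperSet_empty f.exp p.1
        rw [stdSet_empty] at h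
        exact h)) }
  have : IsIso φ := isIso_of_forall_degree φ fun d => by
    refine ⟨fun p q h => Subtype.ext (MvPolynomial.ext _ _ fun a => ?_), fun x => ?_⟩
    · have h1 := congrFun (congrArg coeffFun h) (expVec a)
      change polyCoeff k (cone ∅ 0) p.1 (expVec a) = polyCoeff k (cone ∅ 0) q.1 (expVec a) at h1
      rwa [← stdSet_empty, polyCoeff_expVec (Set.notMem_empty a),
        polyCoeff_expVec (Set.notMem_empty a)] at h1
    · have hx := coeffFun_mem x
      obtain ⟨p, hp, h⟩ := exists_polyCoeff_eq (A := ∅) (φ := coeffFun x) (d := d.val)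
        (by rw [stdSet_empty]; exact hx)
      rw [stdSet_empty] at h
      exact ⟨⟨p, hp⟩, coeffFun_ext h⟩
  asIso φ

/-- The exponent vectors of the monomials in an ideal. -/
def exponents (I : Ideal (MvPolynomial (Fin n) k)) : Set (Fin n →₀ ℕ) :=
  {a | MvPolynomial.monomial a (1 : k) ∈ I}

lemma isUpperSet_exponents (I : Ideal (MvPolynomial (Fin n) k)) : IsUpperSet (exponents I) := by
  intro a b hab ha
  change MvPolynomial.monomial b (1 : k) ∈ I
  have h : MvPolynomial.monomial b (1 : k) =
      MvPolynomial.monomial (b - a) 1 * MvPolynomial.monomial a 1 := by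
    rw [MvPolynomial.monomial_mul, tsub_add_cancel_of_le hab, one_mul]
  rw [h]
  exact I.mul_mem_left _ ha

instance (I : Ideal (MvPolynomial (Fin n) k)) : (stdSet (exponents I)).OrdConnected :=
  ordConnected_stdSet (isUpperSet_exponents I)

lemma IsMonomialIdeal.mem_iff {I : Ideal (MvPolynomial (Fin n) k)} (hI : IsMonomialIdeal I)
    {p : MvPolynomial (Fin n) k} : p ∈ I ↔ ∀ a ∈ p.support, a ∈ exponents I := by
  classical
  obtain ⟨S, rfl⟩ := hI
  rw [MvPolynomial.mem_ideal_span_monomial_image]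
  refine forall₂_congr fun a _ => ?_
  change _ ↔ MvPolynomial.monomial a (1 : k) ∈
    Ideal.span ((fun a => MvPolynomial.monomial a (1 : k)) '' S)
  rw [MvPolynomial.mem_ideal_span_monomial_image]
  simp [MvPolynomial.support_monomial]

lemma IsMonomialIdeal.mem_iff_polyCoeff {I : Ideal (MvPolynomial (Fin n) k)}
    (hI : IsMonomialIdeal I) {p : MvPolynomial (Fin n) k} :
    p ∈ I ↔ polyCoeff k (stdSet (exponents I)) p = 0 := by
  rw [hI.mem_iff]
  constructor
  · intro h
    ext c
    by_cases hc : c ∈ stdSet (exponents I)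
    · obtain ⟨a, rfl, ha⟩ := hc
      rw [polyCoeff_expVec ha]
      by_contra h0
      exact ha (h a (MvPolynomial.mem_support_iff.2 h0))
    · exact polyCoeff_of_notMem hc p
  · intro h a ha
    by_contra h0
    refine MvPolynomial.mem_support_iff.1 ha ?_
    rw [← polyCoeff_expVec h0, h]
    rfl

/-- The map induced by `polyCoeff` on the quotient by a monomial ideal. -/
def quotientCoeff {I : Ideal (MvPolynomial (Fin n) k)} (hI : IsMonomialIdeal I) :
    (MvPolynomial (Fin n) k ⧸ I) →ₗ[k] ((Fin n → ℤ) → k) :=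
  (Submodule.liftQ (I.restrictScalars k) (polyCoeff k (stdSet (exponents I)))
    fun _ hp => hI.mem_iff_polyCoeff.1 hp) ∘ₗ
    (Submodule.Quotient.restrictScalarsEquiv k I).symm.toLinearMap

/-- The quotient by a monomial ideal has the monomials outside the ideal as a basis. -/
def quotientRingIso {I : Ideal (MvPolynomial (Fin n) k)} (hI : IsMonomialIdeal I) :
    quotientRing I ≅ monomialModule k (stdSet (exponents I)) 0 :=
  let φ : quotientRing I ⟶ monomialModule k (stdSet (exponents I)) 0 :=
    { app := fun d => ModuleCat.ofHom ((quotientCoeff hI).restrict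
        (p := (polyPart n k d.val).map (Ideal.Quotient.mkₐ k I).toLinearMap)
        (q := monomialPart k (stdSet (exponents I)) 0 d.val)
        (by rintro _ ⟨p, hp, rfl⟩; exact polyCoeff_mem hp))
      naturality := fun d e f => ModuleCat.hom_ext (LinearMap.ext fun x => Subtype.ext (by
        obtain ⟨_, p, hp, rfl⟩ := x
        exact polyCoeff_monomial_mul (isUpperSet_exponents I) f.exp p)) }
  have : IsIso φ := isIso_of_forall_degree φ fun d => by
    refine ⟨(injective_iff_map_eq_zero _).2 fun x h => ?_, fun x => ?_⟩
    · obtain ⟨_, p, hp, rfl⟩ := x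
      exact Subtype.ext (Ideal.Quotient.eq_zero_iff_mem.2
        (hI.mem_iff_polyCoeff.2 (congrArg coeffFun h)))
    · obtain ⟨p, hp, h⟩ := exists_polyCoeff_eq (coeffFun_mem x)
      exact ⟨⟨_, p, hp, rfl⟩, coeffFun_ext h⟩
  asIso φ

lemma reg_gradedExt_le {I : Ideal (MvPolynomial (Fin n) k)} (hI : IsWeaklyStable I) (i : ℕ) :
    reg (gradedExt i (quotientRing I) (polyRing n k)) ≤ ((-(i : ℝ) : ℝ) : EReal) := by
  -- With `m = n` the hypothesis on initial parts is vacuous, since `initialPart n a = a`.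
  have h : ExtBounds n (monomialModule k (stdSet (exponents I)) 0) :=
    extBounds_stdSet n le_rfl _ (isUpperSet_exponents I) hI.2 fun a ha => by
      convert ha using 1
      ext j
      exact initialPart_of_lt j.isLt
  have e : gradedExt i (monomialModule k (stdSet (exponents I)) 0) (coneModule k ∅ 0 0) ≅
      gradedExt i (quotientRing I) (polyRing n k) :=
    asIso (gradedExtMapLeft i (quotientRingIso hI.1).hom _) ≪≫
      asIso (gradedExtMapRight i _ (polyRingIso n k).inv)
  have := reg_le ((h.vanish_above i).of_iso e)
  simpa using this

end GradedReg

end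

theorem theorem3 {n : ℕ} {k : Type u} [Field k] (I : Ideal (MvPolynomial (Fin n) k))
    (hI : GradedReg.IsWeaklyStable I) (i : ℕ) :
    GradedReg.reg (GradedReg.gradedExt i (GradedReg.quotientRing I) (GradedReg.polyRing n k)) ≤
      ((-(i : ℝ) : ℝ) : EReal) :=
  GradedReg.reg_gradedExt_le hI i
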